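/- Work in the two-sorted language of second-order arithmetic, with number variables, set variables, and the symbols $0,1,+,\cdot,<,\in$. Its structures are of the form $\langle M,\mathcal X\rangle$, where $M$ interprets $0,1,+,\cdot,<$ and the set variables range over a nonempty family $\mathcal X$ of subsets of $M$. A theorem of a theory $T$ is a sentence true in every structure satisfying $T$ (by the completeness theorem, this is the same as a sentence provable from $T$). $\mathsf{RCA}^*_0$ is the theory axiomatized by the basic axioms of second-order arithmetic ($x+1\neq 0$; $x+1=y+1\to x=y$; $x+0=x$; $x+(y+1)=(x+y)+1$; $x\cdot 0=0$; $x\cdot(y+1)=x\cdot y+x$; $\neg\, x<0$; $x<y+1\leftrightarrow x<y\vee x=y$), induction for $\Delta^0_0$ formulas, the axiom $\exp$ stating that $2^x$ exists for every $x$, and $\Delta^0_1$ comprehension; number and set parameters are allowed in induction and comprehension. $\mathrm{WKL}$ is the sentence: every infinite binary tree (an infinite set of finite binary strings closed under initial segments) has an infinite branch (an infinite subset that is closed under initial segments and linearly ordered by the initial-segment relation). A $\Pi^1_2$ sentence is one of the form $\forall X_1\cdots\forall X_m\,\exists Y_1\cdots\exists Y_n\,\theta$ where $\theta$ has no set quantifiers.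 **Proposition.** The theory $\mathsf{RCA}^*_0+\neg\mathrm{WKL}$ is a $\Pi^1_2$-conservative extension of $\mathsf{RCA}^*_0$: every theorem of $\mathsf{RCA}^*_0$ is a theorem of $\mathsf{RCA}^*_0+\neg\mathrm{WKL}$, and every $\Pi^1_2$ sentence that is a theorem of $\mathsf{RCA}^*_0+\neg\mathrm{WKL}$ is a theorem of $\mathsf{RCA}^*_0$. -/

import Mathlib

universe u

namespace SecondOrderArith

/-! ## The language of second-order arithmetic

Two-sorted formulas with `k` free set variables and `n` free number variables. Variables are
numbered by depth: inside `allNum φ` the newly bound number variable is the last one,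
`Fin.last n`, and the older ones keep their numbers (and likewise for set variables). -/

/-- Numerical terms over `0, 1, +, ·` in the number variables `x₀, …, xₙ₋₁`. -/
inductive Term (n : ℕ) : Type
  | var (i : Fin n) : Term n
  | zero : Term n
  | one : Term n
  | add (s t : Term n) : Term n
  | mul (s t : Term n) : Term n

namespace Term

variable {n m : ℕ}

instance : Zero (Term n) := ⟨Term.zero⟩
instance : One (Term n) := ⟨Term.one⟩
instance : Add (Term n) := ⟨Term.add⟩
instance : Mul (Term n) := ⟨Term.mul⟩

/-- Simultaneous substitution of terms for the variables. -/
def subst (σ : Fin n → Term m) : Term n → Term m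
  | var i => σ i
  | zero => zero
  | one => one
  | add s t => add (s.subst σ) (t.subst σ)
  | mul s t => mul (s.subst σ) (t.subst σ)

/-- The same term, in a context with one more (fresh) variable. -/
def lift (t : Term n) : Term (n + 1) := t.subst fun i => var i.castSucc

/-- The most recently bound variable. -/
def new : Term (n + 1) := var (Fin.last n)

end Term

/-- Formulas of second-order arithmetic with free set variables `X₀, …, Xₖ₋₁` and free number
variables `x₀, …, xₙ₋₁`. -/
inductive Formula : ℕ → ℕ → Type
  | eq {k n : ℕ} (s t : Term n) : Formula k n
  | lt {k n : ℕ} (s t : Term n) : Formula k n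
  | mem {k n : ℕ} (t : Term n) (X : Fin k) : Formula k n
  | falsum {k n : ℕ} : Formula k n
  | imp {k n : ℕ} (φ ψ : Formula k n) : Formula k n
  | allNum {k n : ℕ} (φ : Formula k (n + 1)) : Formula k n
  | allSet {k n : ℕ} (φ : Formula (k + 1) n) : Formula k n

/-- Sentences: formulas without free variables. -/
abbrev Sentence : Type := Formula 0 0

namespace Formula

variable {k n l m : ℕ}

def not (φ : Formula k n) : Formula k n := φ.imp falsum
def and (φ ψ : Formula k n) : Formula k n := (φ.imp ψ.not).not
def or (φ ψ : Formula k n) : Formula k n := φ.not.imp ψ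
def iff (φ ψ : Formula k n) : Formula k n := (φ.imp ψ).and (ψ.imp φ)
def exNum (φ : Formula k (n + 1)) : Formula k n := φ.not.allNum.not
def exSet (φ : Formula (k + 1) n) : Formula k n := φ.not.allSet.not

/-- The bounded quantifier `∀ x < t, φ`; the term `t` does not contain the bound variable. -/
def ballNum (t : Term n) (φ : Formula k (n + 1)) : Formula k n :=
  allNum ((lt Term.new t.lift).imp φ)

/-- Simultaneous (capture-avoiding) renaming of the set variables along `ρ` and substitution of
terms `σ` for the number variables. -/
def subst : {k n l m : ℕ} → Formula k n → (Fin k → Fin l) → (Fin n → Term m) → Formula l m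
  | _, _, _, _, eq s t, _, σ => eq (s.subst σ) (t.subst σ)
  | _, _, _, _, lt s t, _, σ => lt (s.subst σ) (t.subst σ)
  | _, _, _, _, mem t X, ρ, σ => mem (t.subst σ) (ρ X)
  | _, _, _, _, falsum, _, _ => falsum
  | _, _, _, _, imp φ ψ, ρ, σ => imp (φ.subst ρ σ) (ψ.subst ρ σ)
  | _, _, _, m, allNum φ, ρ, σ =>
      allNum (φ.subst ρ
        (Fin.snoc (α := fun _ => Term (m + 1)) (fun i => (σ i).lift) Term.new))
  | _, _, l, _, allSet φ, ρ, σ =>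
      allSet (φ.subst
        (Fin.snoc (α := fun _ => Fin (l + 1)) (fun i => (ρ i).castSucc) (Fin.last l)) σ)

/-- `φ(0)`, where `0` is substituted for the last number variable. -/
def atZero (φ : Formula k (n + 1)) : Formula k n :=
  φ.subst id (Fin.snoc (α := fun _ => Term n) Term.var 0)

/-- `φ(x + 1)`, where `x` is the last number variable. -/
def atSucc (φ : Formula k (n + 1)) : Formula k (n + 1) :=
  φ.subst id
    (Fin.snoc (α := fun _ => Term (n + 1)) (fun i => Term.var i.castSucc) (Term.new + 1))

/-- The same formula, in a context with one more (fresh) set variable. -/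
def liftSet (φ : Formula k n) : Formula (k + 1) n := φ.subst Fin.castSucc Term.var

/-- Universal closure with respect to the number variables. -/
def closeNum {k : ℕ} : {n : ℕ} → Formula k n → Formula k 0
  | 0, φ => φ
  | _ + 1, φ => closeNum φ.allNum

/-- Universal closure with respect to the set variables. -/
def closeSet : {k : ℕ} → Formula k 0 → Sentence
  | 0, φ => φ
  | _ + 1, φ => closeSet φ.allSet

/-- Universal closure. -/
def close (φ : Formula k n) : Sentence := φ.closeNum.closeSet

end Formula

open Formula

/-! ## Classes of formulas -/

/-- `Δ⁰₀` formulas: only bounded number quantifiers, no set quantifiers; set and number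
parameters are allowed. -/
inductive IsDelta00 : {k n : ℕ} → Formula k n → Prop
  | eq {k n : ℕ} (s t : Term n) : IsDelta00 (Formula.eq s t : Formula k n)
  | lt {k n : ℕ} (s t : Term n) : IsDelta00 (Formula.lt s t : Formula k n)
  | mem {k n : ℕ} (t : Term n) (X : Fin k) : IsDelta00 (Formula.mem t X)
  | falsum {k n : ℕ} : IsDelta00 (Formula.falsum : Formula k n)
  | imp {k n : ℕ} {φ ψ : Formula k n} : IsDelta00 φ → IsDelta00 ψ → IsDelta00 (φ.imp ψ)
  | ball {k n : ℕ} (t : Term n) {φ : Formula k (n + 1)} :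
      IsDelta00 φ → IsDelta00 (Formula.ballNum t φ)

/-- `Σ⁰₁` formulas: a block of existential number quantifiers followed by a `Δ⁰₀` formula. -/
inductive IsSigma01 : {k n : ℕ} → Formula k n → Prop
  | delta {k n : ℕ} {φ : Formula k n} : IsDelta00 φ → IsSigma01 φ
  | ex {k n : ℕ} {φ : Formula k (n + 1)} : IsSigma01 φ → IsSigma01 φ.exNum

/-- `Π⁰₁` formulas: a block of universal number quantifiers followed by a `Δ⁰₀` formula. -/
inductive IsPi01 : {k n : ℕ} → Formula k n → Prop
  | delta {k n : ℕ} {φ : Formula k n} : IsDelta00 φ → IsPi01 φ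
  | all {k n : ℕ} {φ : Formula k (n + 1)} : IsPi01 φ → IsPi01 φ.allNum

/-- Arithmetical formulas: no set quantifiers. -/
inductive IsArithmetical : {k n : ℕ} → Formula k n → Prop
  | eq {k n : ℕ} (s t : Term n) : IsArithmetical (Formula.eq s t : Formula k n)
  | lt {k n : ℕ} (s t : Term n) : IsArithmetical (Formula.lt s t : Formula k n)
  | mem {k n : ℕ} (t : Term n) (X : Fin k) : IsArithmetical (Formula.mem t X)
  | falsum {k n : ℕ} : IsArithmetical (Formula.falsum : Formula k n)
  | imp {k n : ℕ} {φ ψ : Formula k n} :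
      IsArithmetical φ → IsArithmetical ψ → IsArithmetical (φ.imp ψ)
  | all {k n : ℕ} {φ : Formula k (n + 1)} : IsArithmetical φ → IsArithmetical φ.allNum

/-- `Σ¹₁` formulas: a block of existential set quantifiers followed by an arithmetical formula. -/
inductive IsSigma11 : {k n : ℕ} → Formula k n → Prop
  | arith {k n : ℕ} {φ : Formula k n} : IsArithmetical φ → IsSigma11 φ
  | ex {k n : ℕ} {φ : Formula (k + 1) n} : IsSigma11 φ → IsSigma11 φ.exSet

/-- `Π¹₂` formulas: a block of universal set quantifiers followed by a `Σ¹₁` formula. -/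
inductive IsPi12 : {k n : ℕ} → Formula k n → Prop
  | sigma {k n : ℕ} {φ : Formula k n} : IsSigma11 φ → IsPi12 φ
  | all {k n : ℕ} {φ : Formula (k + 1) n} : IsPi12 φ → IsPi12 φ.allSet

/-! ## Structures, satisfaction, consequence -/

/-- A structure `⟨M, 𝒳⟩` for the language of second-order arithmetic: the set variables range
over a nonempty family `𝒳` of subsets of the first-order universe `M`. -/
structure Model : Type (u + 1) where
  carrier : Type u
  zero : carrier
  one : carrier
  add : carrier → carrier → carrier
  mul : carrier → carrier → carrier
  lt : carrier → carrier → Prop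
  sets : Set (Set carrier)
  sets_nonempty : sets.Nonempty

/-- The value of a term under an assignment. -/
def Term.val (M : Model.{u}) {n : ℕ} (v : Fin n → M.carrier) : Term n → M.carrier
  | .var i => v i
  | .zero => M.zero
  | .one => M.one
  | .add s t => M.add (s.val M v) (t.val M v)
  | .mul s t => M.mul (s.val M v) (t.val M v)

/-- Satisfaction of a formula under assignments `V` to the set variables and `v` to the number
variables. -/
def Formula.Realize (M : Model.{u}) :
    {k n : ℕ} → Formula k n → (Fin k → Set M.carrier) → (Fin n → M.carrier) → Prop
  | _, _, .eq s t, _, v => s.val M v = t.val M v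
  | _, _, .lt s t, _, v => M.lt (s.val M v) (t.val M v)
  | _, _, .mem t X, V, v => t.val M v ∈ V X
  | _, _, .falsum, _, _ => False
  | _, _, .imp φ ψ, V, v => φ.Realize M V v → ψ.Realize M V v
  | _, _, .allNum φ, V, v =>
      ∀ a : M.carrier, φ.Realize M V (Fin.snoc (α := fun _ => M.carrier) v a)
  | _, _, .allSet φ, V, v =>
      ∀ S ∈ M.sets, φ.Realize M (Fin.snoc (α := fun _ => Set M.carrier) V S) v

/-- Truth of a sentence in a structure. -/
def Model.Satisfies (M : Model.{u}) (φ : Sentence) : Prop :=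
  φ.Realize M Fin.elim0 Fin.elim0

/-- Theories are sets of sentences. -/
abbrev Theory : Type := Set Sentence

/-- `φ` is a theorem (a logical consequence) of `T`. -/
def Theory.Entails (T : Theory) (φ : Sentence) : Prop :=
  ∀ M : Model.{u}, (∀ ψ ∈ T, M.Satisfies ψ) → M.Satisfies φ

/-- `T` is a `Γ`-conservative extension of `T₀`: every theorem of `T₀` is a theorem of `T`, and
every theorem of `T` that belongs to the class `Γ` is a theorem of `T₀`. -/
def IsConservativeExtension (Γ : Sentence → Prop) (T T₀ : Theory) : Prop :=
  (∀ φ : Sentence, Theory.Entails.{u} T₀ φ → Theory.Entails.{u} T φ) ∧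
    ∀ φ : Sentence, Γ φ → Theory.Entails.{u} T φ → Theory.Entails.{u} T₀ φ

/-! ## The theory `RCA*₀` -/

/-- The basic axioms of second-order arithmetic. -/
def basicAxioms : Theory :=
  let x : Term 2 := .var 0
  let y : Term 2 := .var 1
  { close (k := 0) (eq (x + 1) 0).not,
    close (k := 0) ((eq (x + 1) (y + 1)).imp (eq x y)),
    close (k := 0) (eq (x + 0) x),
    close (k := 0) (eq (x + (y + 1)) (x + y + 1)),
    close (k := 0) (eq (x * 0) 0),
    close (k := 0) (eq (x * (y + 1)) (x * y + x)),
    close (k := 0) (lt x 0).not,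
    close (k := 0) ((lt x (y + 1)).iff ((lt x y).or (eq x y))) }

/-- Induction for `φ` with respect to the last number variable:
`φ(0) ∧ ∀ x (φ(x) → φ(x + 1)) → ∀ x φ(x)`, universally closed. -/
def inductionAxiom {k n : ℕ} (φ : Formula k (n + 1)) : Sentence :=
  close ((φ.atZero.and (allNum (φ.imp φ.atSucc))).imp (allNum φ))

/-- Induction for `Δ⁰₀` formulas (with number and set parameters). -/
def delta00Induction : Theory :=
  {θ | ∃ (k n : ℕ) (φ : Formula k (n + 1)), IsDelta00 φ ∧ θ = inductionAxiom φ}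

/-- Comprehension for `φ`, provided that it is equivalent to `ψ`, with respect to the last number
variable: `∀ x (φ(x) ↔ ψ(x)) → ∃ X ∀ x (x ∈ X ↔ φ(x))`, universally closed. -/
def comprehensionAxiom {k n : ℕ} (φ ψ : Formula k (n + 1)) : Sentence :=
  close ((allNum (φ.iff ψ)).imp
    (exSet (allNum ((mem Term.new (Fin.last k)).iff φ.liftSet))))

/-- `Δ⁰₁` comprehension (with number and set parameters). -/
def delta01Comprehension : Theory :=
  {θ | ∃ (k n : ℕ) (φ ψ : Formula k (n + 1)),
    IsSigma01 φ ∧ IsPi01 ψ ∧ θ = comprehensionAxiom φ ψ}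

/-- `c` is the remainder of `a` modulo `1 + (i + 1) · b`, that is, `β(a, b, i) = c` for Gödel's
`β` function. -/
def betaEq {k n : ℕ} (a b i c : Term n) : Formula k n :=
  (lt c (1 + (i + 1) * b)).and
    (exNum (eq a.lift (Term.new * (1 + (i + 1) * b).lift + c.lift)))

/-- `2 ^ x = y`: for some `a, b` the sequence `i ↦ β(a, b, i)` starts with `1`, doubles at each
step `i < x`, and has the value `y` at `x`. -/
def expEq {k n : ℕ} (x y : Term n) : Formula k n :=
  let a : Term (n + 2) := .var (Fin.last n).castSucc
  let b : Term (n + 2) := .var (Fin.last (n + 1))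
  let i : Term (n + 4) := .var (Fin.last (n + 2)).castSucc
  let c : Term (n + 4) := .var (Fin.last (n + 3))
  exNum (exNum ((betaEq a b 0 1).and
    ((ballNum x.lift.lift (exNum
      ((betaEq a.lift.lift b.lift.lift i c).and
        (betaEq a.lift.lift b.lift.lift (i + 1) (c + c))))).and
    (betaEq a b x.lift.lift y.lift.lift))))

/-- The axiom `exp`: exponentiation is total. -/
def expAxiom : Sentence :=
  allNum (exNum (expEq (.var 0) (.var 1)))

/-- `RCA*₀`: the basic axioms, `Δ⁰₀` induction, `exp`, and `Δ⁰₁` comprehension. -/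
def RCAStar0 : Theory :=
  basicAxioms ∪ delta00Induction ∪ {expAxiom} ∪ delta01Comprehension

/-! ## Weak König's lemma

A finite binary string `σ` is coded by the number whose binary notation is `1σ`. So the codes are
exactly the numbers `> 0`, and the string coded by `s` is an initial segment of the one coded
by `t` if and only if `t = s · p + r` for some power of two `p` and some `r < p`. -/

/-- `s` divides `t`. -/
def dvd {k n : ℕ} (s t : Term n) : Formula k n :=
  exNum (eq (s.lift * Term.new) t.lift)

/-- `p` is a power of two: it is positive and each of its divisors `> 1` is even. -/
def isPowTwo {k n : ℕ} (p : Term n) : Formula k n :=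
  (lt 0 p).and
    (allNum (((dvd Term.new p.lift).and (lt 1 Term.new)).imp (dvd (1 + 1) Term.new)))

/-- `s` and `t` are codes of binary strings, the first one an initial segment of the second. -/
def isPrefix {k n : ℕ} (s t : Term n) : Formula k n :=
  let p : Term (n + 2) := .var (Fin.last n).castSucc
  let r : Term (n + 2) := .var (Fin.last (n + 1))
  (lt 0 s).and
    (exNum (exNum ((isPowTwo p).and ((lt r p).and (eq t.lift.lift (s.lift.lift * p + r))))))

/-- `T` is a binary tree: a set of (codes of) finite binary strings that is closed under initial
segments. -/
def isTree {k : ℕ} (T : Fin k) : Formula k 0 :=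
  (allNum ((mem (.var 0) T).imp (lt 0 (.var 0)))).and
    (allNum (allNum (((mem (.var 0) T).and (isPrefix (.var 1) (.var 0))).imp (mem (.var 1) T))))

/-- `X` is infinite, that is, unbounded. -/
def isInfinite {k : ℕ} (X : Fin k) : Formula k 0 :=
  allNum (exNum ((mem (.var 1) X).and (lt (.var 0) (.var 1))))

/-- `B` is an infinite branch of `T`: an infinite set of strings in `T` that is closed under
initial segments and any two members of which are comparable. -/
def isInfiniteBranch {k : ℕ} (B T : Fin k) : Formula k 0 :=
  (isTree B).and ((isInfinite B).and
    ((allNum ((mem (.var 0) B).imp (mem (.var 0) T))).and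
      (allNum (allNum (((mem (.var 0) B).and (mem (.var 1) B)).imp
        ((isPrefix (.var 0) (.var 1)).or (isPrefix (.var 1) (.var 0))))))))

/-- Weak König's lemma: every infinite binary tree has an infinite branch. -/
def WKL : Sentence :=
  allSet (((isTree 0).and (isInfinite 0)).imp (exSet (isInfiniteBranch 1 0)))

end SecondOrderArith

set_option linter.unusedSectionVars false

/-! Suppose that a `Π¹₂` sentence `∀ X ∃ Y θ` fails in a model `⟨M, 𝒳⟩` of `RCA*₀`, and let `A₁, …,
Aₘ` in `𝒳` be a counterexample. Code the `Aᵢ` into one set `J ∈ 𝒳` and shrink `𝒳` to those of its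
members that are computable from `J` with number parameters. The numbers stay the same, `θ` is
arithmetical, and there are fewer candidates for `Y`, so the sentence still fails. It remains to see
that the smaller structure satisfies `RCA*₀` and refutes `WKL`; this is `exists_subfamily`.

For `RCA*₀` a notion of computability is needed that works without `Σ⁰₁` induction. Programs are
built from basic functions by composition, pairing and search. A computation is a finite set of
facts, each following in one step from facts in the set. Finite sets are coded by divisibility
(`exists_code`), which is possible because exponentiation is total (`exists_iterate`). A search up
to `y` has to merge the computations for all `z < y`; a common bound on them comes from collection
(`collection`), a consequence of `Δ⁰₁` comprehension and `Δ⁰₀` induction. Primitive recursion is not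
needed: search decides bounded quantifiers (`D0.isComp`) and yields `Δ⁰₁` comprehension
(`arith_compSets`).

`WKL` fails because of a Kleene tree. A string belongs to it if, for each `e`, its bit number `e`
differs from the output of program `e` on input `2 ^ e`, as far as witnesses below the code of the
string reveal this output. At most one bit is forbidden at each place, so the tree is infinite. From
a branch in the family one reads off a set `D` in the family, where `2 ^ e ∈ D` if and only if bit
number `e` is `1`. If `e` is a program for `D`, its output on `2 ^ e` is the very bit that the
branch must avoid (`exists_tree`, `exists_tree_compSets`).

Definability is treated semantically: `D0` stands for `Δ⁰₀` with parameters, and formulas are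
translated to and from it only where the axioms are used. -/

namespace SecondOrderArith

/-! ## Bounded relations -/

section Definability

variable {N : Type u} [Add N] [Mul N] {n m : ℕ}

/-- Polynomial functions with parameters. -/
inductive PolyFun : {n : ℕ} → ((Fin n → N) → N) → Prop
  | var {n : ℕ} (i : Fin n) : PolyFun (fun v => v i)
  | const {n : ℕ} (c : N) : PolyFun (fun _ : Fin n → N => c)
  | add {n : ℕ} {s t : (Fin n → N) → N} : PolyFun s → PolyFun t → PolyFun (fun v => s v + t v)
  | mul {n : ℕ} {s t : (Fin n → N) → N} : PolyFun s → PolyFun t → PolyFun (fun v => s v * t v)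

theorem PolyFun.subst {t : (Fin n → N) → N} (ht : PolyFun t) {σ : Fin n → (Fin m → N) → N}
    (hσ : ∀ i, PolyFun (σ i)) : PolyFun (fun v => t fun i => σ i v) := by
  induction ht generalizing m with
  | var i => exact hσ i
  | const c => exact .const c
  | add _ _ ih₁ ih₂ => exact .add (ih₁ hσ) (ih₂ hσ)
  | mul _ _ ih₁ ih₂ => exact .mul (ih₁ hσ) (ih₂ hσ)

theorem PolyFun.wk {t : (Fin n → N) → N} (ht : PolyFun t) :
    PolyFun (fun v : Fin (n + 1) → N => t (Fin.init v)) :=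
  ht.subst fun i => .var i.castSucc

variable [LT N]

/-- Relations that are `Δ⁰₀` in number parameters and in set parameters from `X`. -/
inductive D0 (X : Set (Set N)) : {n : ℕ} → ((Fin n → N) → Prop) → Prop
  | eq {n : ℕ} {s t : (Fin n → N) → N} : PolyFun s → PolyFun t → D0 X (fun v => s v = t v)
  | lt {n : ℕ} {s t : (Fin n → N) → N} : PolyFun s → PolyFun t → D0 X (fun v => s v < t v)
  | mem {n : ℕ} {s : (Fin n → N) → N} {A : Set N} : A ∈ X → PolyFun s → D0 X (fun v => s v ∈ A)
  | falsum {n : ℕ} : D0 X (fun _ : Fin n → N => False)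
  | imp {n : ℕ} {R S : (Fin n → N) → Prop} : D0 X R → D0 X S → D0 X (fun v => R v → S v)
  | ball {n : ℕ} {t : (Fin n → N) → N} {R : (Fin (n + 1) → N) → Prop} : PolyFun t → D0 X R →
      D0 X (fun v => ∀ a, a < t v → R (Fin.snoc (α := fun _ => N) v a))

theorem D0.subst {X : Set (Set N)} {R : (Fin n → N) → Prop} (hR : D0 X R)
    {σ : Fin n → (Fin m → N) → N} (hσ : ∀ i, PolyFun (σ i)) :
    D0 X (fun v => R fun i => σ i v) := by
  induction hR generalizing m with
  | eq hs ht => exact .eq (hs.subst hσ) (ht.subst hσ)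
  | lt hs ht => exact .lt (hs.subst hσ) (ht.subst hσ)
  | mem hA hs => exact .mem hA (hs.subst hσ)
  | falsum => exact .falsum
  | imp _ _ ih₁ ih₂ => exact .imp (ih₁ hσ) (ih₂ hσ)
  | @ball n t R ht _ ih =>
    have key : ∀ i : Fin (n + 1), PolyFun (Fin.snoc (α := fun _ => (Fin (m + 1) → N) → N)
        (fun i v => σ i (Fin.init v)) (fun v => v (Fin.last m)) i) := by
      intro i
      refine Fin.lastCases ?_ (fun i => ?_) i
      · simpa using PolyFun.var _
      · simpa using (hσ i).wk
    have h := D0.ball (ht.subst hσ) (ih key)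
    convert h using 6
    rename_i i
    refine Fin.lastCases ?_ (fun i => ?_) i <;> simp

theorem D0.wk {X : Set (Set N)} {R : (Fin n → N) → Prop} (hR : D0 X R) :
    D0 X (fun v : Fin (n + 1) → N => R (Fin.init v)) :=
  hR.subst fun i => .var i.castSucc

theorem D0.mono {X Y : Set (Set N)} (h : X ⊆ Y) {R : (Fin n → N) → Prop} (hR : D0 X R) :
    D0 Y R := by
  induction hR with
  | eq hs ht => exact .eq hs ht
  | lt hs ht => exact .lt hs ht
  | mem hA hs => exact .mem (h hA) hs
  | falsum => exact .falsum
  | imp _ _ ih₁ ih₂ => exact .imp ih₁ ih₂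
  | ball ht _ ih => exact .ball ht ih

end Definability

/-! ## Semantics of formulas -/

section Semantics

variable (M : Model.{u}) {k l n m : ℕ}

instance : Zero M.carrier := ⟨M.zero⟩
instance : One M.carrier := ⟨M.one⟩
instance : Add M.carrier := ⟨M.add⟩
instance : Mul M.carrier := ⟨M.mul⟩
instance : LT M.carrier := ⟨M.lt⟩

@[simp] theorem Term.val_var (v : Fin n → M.carrier) (i : Fin n) : (Term.var i).val M v = v i := rfl
@[simp] theorem Term.val_zero (v : Fin n → M.carrier) : (0 : Term n).val M v = 0 := rfl
@[simp] theorem Term.val_one (v : Fin n → M.carrier) : (1 : Term n).val M v = 1 := rfl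
@[simp] theorem Term.val_add (v : Fin n → M.carrier) (s t : Term n) :
    (s + t).val M v = s.val M v + t.val M v := rfl
@[simp] theorem Term.val_mul (v : Fin n → M.carrier) (s t : Term n) :
    (s * t).val M v = s.val M v * t.val M v := rfl

theorem Term.val_subst (σ : Fin n → Term m) (t : Term n) (v : Fin m → M.carrier) :
    (t.subst σ).val M v = t.val M fun i => (σ i).val M v := by
  induction t with
  | var i => rfl
  | zero => rfl
  | one => rfl
  | add s t hs ht => simp only [Term.subst, Term.val, hs, ht]
  | mul s t hs ht => simp only [Term.subst, Term.val, hs, ht]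

@[simp] theorem Term.val_lift (t : Term n) (v : Fin n → M.carrier) (a : M.carrier) :
    t.lift.val M (Fin.snoc (α := fun _ => M.carrier) v a) = t.val M v := by
  simp [Term.lift, Term.val_subst]

@[simp] theorem Term.val_new (v : Fin n → M.carrier) (a : M.carrier) :
    (Term.new).val M (Fin.snoc (α := fun _ => M.carrier) v a) = a := by
  simp [Term.new]

theorem Term.polyFun (t : Term n) : PolyFun (fun v => t.val M v) := by
  induction t with
  | var i => exact .var i
  | zero => exact .const M.zero
  | one => exact .const M.one
  | add s t hs ht => exact .add hs ht
  | mul s t hs ht => exact .mul hs ht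

variable (V : Fin k → Set M.carrier) (v : Fin n → M.carrier)

@[simp] theorem Formula.realize_eq (s t : Term n) :
    (Formula.eq s t).Realize M V v ↔ s.val M v = t.val M v := Iff.rfl
@[simp] theorem Formula.realize_lt (s t : Term n) :
    (Formula.lt s t).Realize M V v ↔ s.val M v < t.val M v := Iff.rfl
@[simp] theorem Formula.realize_mem (t : Term n) (i : Fin k) :
    (Formula.mem t i).Realize M V v ↔ t.val M v ∈ V i := Iff.rfl
@[simp] theorem Formula.realize_falsum : (Formula.falsum).Realize M V v ↔ False := Iff.rfl
@[simp] theorem Formula.realize_imp (φ ψ : Formula k n) :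
    (φ.imp ψ).Realize M V v ↔ (φ.Realize M V v → ψ.Realize M V v) := Iff.rfl
@[simp] theorem Formula.realize_allNum (φ : Formula k (n + 1)) :
    φ.allNum.Realize M V v ↔
      ∀ a : M.carrier, φ.Realize M V (Fin.snoc (α := fun _ => M.carrier) v a) := Iff.rfl
@[simp] theorem Formula.realize_allSet (φ : Formula (k + 1) n) :
    φ.allSet.Realize M V v ↔
      ∀ S ∈ M.sets, φ.Realize M (Fin.snoc (α := fun _ => Set M.carrier) V S) v := Iff.rfl
@[simp] theorem Formula.realize_not (φ : Formula k n) :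
    φ.not.Realize M V v ↔ ¬ φ.Realize M V v := Iff.rfl
@[simp] theorem Formula.realize_and (φ ψ : Formula k n) :
    (φ.and ψ).Realize M V v ↔ φ.Realize M V v ∧ ψ.Realize M V v := by
  simp [Formula.and]
@[simp] theorem Formula.realize_or (φ ψ : Formula k n) :
    (φ.or ψ).Realize M V v ↔ φ.Realize M V v ∨ ψ.Realize M V v := by
  simp [Formula.or, or_iff_not_imp_left]
@[simp] theorem Formula.realize_iff (φ ψ : Formula k n) :
    (φ.iff ψ).Realize M V v ↔ (φ.Realize M V v ↔ ψ.Realize M V v) := by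
  simp [Formula.iff, iff_iff_implies_and_implies]
@[simp] theorem Formula.realize_exNum (φ : Formula k (n + 1)) :
    φ.exNum.Realize M V v ↔
      ∃ a : M.carrier, φ.Realize M V (Fin.snoc (α := fun _ => M.carrier) v a) := by
  simp [Formula.exNum]
@[simp] theorem Formula.realize_exSet (φ : Formula (k + 1) n) :
    φ.exSet.Realize M V v ↔
      ∃ S ∈ M.sets, φ.Realize M (Fin.snoc (α := fun _ => Set M.carrier) V S) v := by
  simp [Formula.exSet]
@[simp] theorem Formula.realize_ballNum (t : Term n) (φ : Formula k (n + 1)) :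
    (φ.ballNum t).Realize M V v ↔
      ∀ a, a < t.val M v → φ.Realize M V (Fin.snoc (α := fun _ => M.carrier) v a) := by
  simp [Formula.ballNum]

theorem Formula.realize_subst (φ : Formula k n) (ρ : Fin k → Fin l) (σ : Fin n → Term m)
    (V : Fin l → Set M.carrier) (v : Fin m → M.carrier) :
    (φ.subst ρ σ).Realize M V v ↔ φ.Realize M (fun i => V (ρ i)) fun i => (σ i).val M v := by
  induction φ generalizing l m with
  | eq s t => simp [Formula.subst, Term.val_subst]
  | lt s t => simp [Formula.subst, Term.val_subst]
  | mem t i => simp [Formula.subst, Term.val_subst]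
  | falsum => simp [Formula.subst]
  | imp φ ψ h₁ h₂ => simp [Formula.subst, h₁, h₂]
  | allNum φ ih =>
    simp only [Formula.subst, realize_allNum, ih]
    refine forall_congr' fun a => ?_
    congr! 1
    ext i
    refine Fin.lastCases ?_ (fun i => ?_) i <;> simp
  | allSet φ ih =>
    simp only [Formula.subst, realize_allSet, ih]
    refine forall₂_congr fun S _ => ?_
    congr! 1
    ext1 i
    refine Fin.lastCases ?_ (fun i => ?_) i <;> simp

@[simp] theorem Formula.realize_atZero (φ : Formula k (n + 1)) :
    φ.atZero.Realize M V v ↔ φ.Realize M V (Fin.snoc (α := fun _ => M.carrier) v 0) := by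
  rw [Formula.atZero, Formula.realize_subst]
  congr! 1
  ext i
  refine Fin.lastCases ?_ (fun i => ?_) i <;> simp

@[simp] theorem Formula.realize_atSucc (φ : Formula k (n + 1)) (a : M.carrier) :
    φ.atSucc.Realize M V (Fin.snoc (α := fun _ => M.carrier) v a) ↔
      φ.Realize M V (Fin.snoc (α := fun _ => M.carrier) v (a + 1)) := by
  rw [Formula.atSucc, Formula.realize_subst]
  congr! 1
  ext i
  refine Fin.lastCases ?_ (fun i => ?_) i <;> simp

@[simp] theorem Formula.realize_liftSet (φ : Formula k n) (S : Set M.carrier) :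
    φ.liftSet.Realize M (Fin.snoc (α := fun _ => Set M.carrier) V S) v ↔ φ.Realize M V v := by
  rw [Formula.liftSet, Formula.realize_subst]
  simp

variable {M}

theorem Formula.realize_closeNum (φ : Formula k n) (V : Fin k → Set M.carrier) :
    φ.closeNum.Realize M V Fin.elim0 ↔ ∀ v, φ.Realize M V v := by
  induction n with
  | zero =>
    refine ⟨fun h v => ?_, fun h => h _⟩
    rwa [Subsingleton.elim v Fin.elim0]
  | succ n ih =>
    rw [Formula.closeNum, ih]
    refine ⟨fun h v => ?_, fun h v a => h _⟩
    rw [← Fin.snoc_init_self v]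
    exact h _ _

theorem Formula.realize_closeSet (φ : Formula k 0) :
    φ.closeSet.Realize M Fin.elim0 Fin.elim0 ↔
      ∀ V, (∀ i, V i ∈ M.sets) → φ.Realize M V Fin.elim0 := by
  induction k with
  | zero =>
    refine ⟨fun h V _ => ?_, fun h => h _ fun i => i.elim0⟩
    rwa [Subsingleton.elim V Fin.elim0]
  | succ k ih =>
    rw [Formula.closeSet, ih]
    refine ⟨fun h V hV => ?_, fun h V hV S hS => h _ fun i => ?_⟩
    · rw [← Fin.snoc_init_self V]
      exact h _ (fun i => hV _) _ (hV _)
    · refine Fin.lastCases ?_ (fun i => ?_) i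
      · simpa using hS
      · simpa using hV i

theorem Model.satisfies_close (φ : Formula k n) :
    M.Satisfies φ.close ↔ ∀ V, (∀ i, V i ∈ M.sets) → ∀ v, φ.Realize M V v := by
  rw [Model.Satisfies, Formula.close, Formula.realize_closeSet]
  simp_rw [Formula.realize_closeNum]

theorem Model.satisfies_inductionAxiom (φ : Formula k (n + 1)) :
    M.Satisfies (inductionAxiom φ) ↔ ∀ V, (∀ i, V i ∈ M.sets) → ∀ v : Fin n → M.carrier,
      φ.Realize M V (Fin.snoc (α := fun _ => M.carrier) v 0) →
      (∀ a, φ.Realize M V (Fin.snoc (α := fun _ => M.carrier) v a) →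
        φ.Realize M V (Fin.snoc (α := fun _ => M.carrier) v (a + 1))) →
      ∀ a, φ.Realize M V (Fin.snoc (α := fun _ => M.carrier) v a) := by
  simp [inductionAxiom, Model.satisfies_close]

theorem Model.satisfies_comprehensionAxiom (φ ψ : Formula k (n + 1)) :
    M.Satisfies (comprehensionAxiom φ ψ) ↔ ∀ V, (∀ i, V i ∈ M.sets) → ∀ v : Fin n → M.carrier,
      (∀ a, φ.Realize M V (Fin.snoc (α := fun _ => M.carrier) v a) ↔
        ψ.Realize M V (Fin.snoc (α := fun _ => M.carrier) v a)) →
      {a | φ.Realize M V (Fin.snoc (α := fun _ => M.carrier) v a)} ∈ M.sets := by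
  simp only [comprehensionAxiom, Model.satisfies_close, Formula.realize_imp,
    Formula.realize_allNum, Formula.realize_iff, Formula.realize_exSet, Formula.realize_mem,
    Formula.realize_liftSet, Term.val_new, Fin.snoc_last]
  refine forall₄_congr fun V _ v _ => ?_
  constructor
  · rintro ⟨S, hS, h⟩
    convert hS
    ext a
    exact (h a).symm
  · intro h
    exact ⟨_, h, fun a => Iff.rfl⟩

/-! ## Bounded relations and `Δ⁰₀` formulas -/

theorem IsDelta00.d0 {φ : Formula k n} (hφ : IsDelta00 φ) {X : Set (Set M.carrier)}
    {V : Fin k → Set M.carrier} (hV : ∀ i, V i ∈ X) : D0 X (fun v => φ.Realize M V v) := by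
  induction hφ generalizing X with
  | eq s t => exact .eq (s.polyFun M) (t.polyFun M)
  | lt s t => exact .lt (s.polyFun M) (t.polyFun M)
  | mem t i => exact .mem (hV i) (t.polyFun M)
  | falsum => exact .falsum
  | imp _ _ h₁ h₂ => exact .imp (h₁ hV) (h₂ hV)
  | ball t _ ih =>
    simp only [Formula.realize_ballNum]
    exact .ball (t.polyFun M) (ih hV)

/-- The tuple `p` only has to list the parameters in `P` and is otherwise arbitrary, so that several
terms can be written over one common tuple. -/
theorem PolyFun.exists_term {t : (Fin n → M.carrier) → M.carrier} (ht : PolyFun t) :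
    ∃ P : List M.carrier, ∀ {l : ℕ} (p : Fin l → M.carrier), (∀ a ∈ P, ∃ i, p i = a) →
      ∃ s : Term (l + n), ∀ v, s.val M (Fin.append p v) = t v := by
  induction ht with
  | var i => exact ⟨[], fun {l} p _ => ⟨.var (Fin.natAdd l i), fun v => by simp⟩⟩
  | const c =>
    refine ⟨[c], fun p hp => ?_⟩
    obtain ⟨i, hi⟩ := hp c (by simp)
    exact ⟨.var (Fin.castAdd _ i), fun v => by simp [hi]⟩
  | add _ _ ih₁ ih₂ =>
    obtain ⟨P, hP⟩ := ih₁
    obtain ⟨Q, hQ⟩ := ih₂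
    refine ⟨P ++ Q, fun p hp => ?_⟩
    obtain ⟨s, hs⟩ := hP p fun a ha => hp a (by simp [ha])
    obtain ⟨t, ht⟩ := hQ p fun a ha => hp a (by simp [ha])
    exact ⟨s + t, fun v => by simp [hs, ht]⟩
  | mul _ _ ih₁ ih₂ =>
    obtain ⟨P, hP⟩ := ih₁
    obtain ⟨Q, hQ⟩ := ih₂
    refine ⟨P ++ Q, fun p hp => ?_⟩
    obtain ⟨s, hs⟩ := hP p fun a ha => hp a (by simp [ha])
    obtain ⟨t, ht⟩ := hQ p fun a ha => hp a (by simp [ha])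
    exact ⟨s * t, fun v => by simp [hs, ht]⟩

/-- This makes the axiom schemes applicable to bounded relations. As for terms, the parameters may
be part of a larger supply: an implication, or the two formulas of a comprehension axiom, must share
their parameters. -/
theorem D0.exists_formula {X : Set (Set M.carrier)} {R : (Fin n → M.carrier) → Prop}
    (hR : D0 X R) :
    ∃ (P : List M.carrier) (S : List (Set M.carrier)), (∀ s ∈ S, s ∈ X) ∧
      ∀ {k l : ℕ} (V : Fin k → Set M.carrier) (p : Fin l → M.carrier),
      (∀ s ∈ S, ∃ i, V i = s) → (∀ a ∈ P, ∃ i, p i = a) →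
      ∃ φ : Formula k (l + n), IsDelta00 φ ∧ ∀ v, φ.Realize M V (Fin.append p v) ↔ R v := by
  induction hR with
  | eq hs ht =>
    obtain ⟨P, hP⟩ := hs.exists_term
    obtain ⟨Q, hQ⟩ := ht.exists_term
    refine ⟨P ++ Q, [], by simp, fun V p _ hp => ?_⟩
    obtain ⟨s, hs⟩ := hP p fun a ha => hp a (by simp [ha])
    obtain ⟨t, ht⟩ := hQ p fun a ha => hp a (by simp [ha])
    exact ⟨_, .eq s t, fun v => by simp [hs, ht]⟩
  | lt hs ht =>
    obtain ⟨P, hP⟩ := hs.exists_term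
    obtain ⟨Q, hQ⟩ := ht.exists_term
    refine ⟨P ++ Q, [], by simp, fun V p _ hp => ?_⟩
    obtain ⟨s, hs⟩ := hP p fun a ha => hp a (by simp [ha])
    obtain ⟨t, ht⟩ := hQ p fun a ha => hp a (by simp [ha])
    exact ⟨_, .lt s t, fun v => by simp [hs, ht]⟩
  | @mem n s A hA hs =>
    obtain ⟨P, hP⟩ := hs.exists_term
    refine ⟨P, [A], by simpa using hA, fun V p hV hp => ?_⟩
    obtain ⟨s, hs⟩ := hP p hp
    obtain ⟨i, hi⟩ := hV A (by simp)
    exact ⟨_, .mem s i, fun v => by simp [hs, hi]⟩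
  | falsum => exact ⟨[], [], by simp, fun V p _ _ => ⟨_, .falsum, fun v => Iff.rfl⟩⟩
  | imp _ _ ih₁ ih₂ =>
    obtain ⟨P, S, hS, h₁⟩ := ih₁
    obtain ⟨Q, T, hT, h₂⟩ := ih₂
    refine ⟨P ++ Q, S ++ T, fun s hs => ?_, fun V p hV hp => ?_⟩
    · rcases List.mem_append.1 hs with h | h
      exacts [hS s h, hT s h]
    obtain ⟨φ, hφ, e₁⟩ := h₁ V p (fun s hs => hV s (by simp [hs])) fun a ha => hp a (by simp [ha])
    obtain ⟨ψ, hψ, e₂⟩ := h₂ V p (fun s hs => hV s (by simp [hs])) fun a ha => hp a (by simp [ha])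
    exact ⟨_, .imp hφ hψ, fun v => by simp [e₁, e₂]⟩
  | ball ht _ ih =>
    obtain ⟨P, hP⟩ := ht.exists_term
    obtain ⟨Q, T, hT, h₂⟩ := ih
    refine ⟨P ++ Q, T, hT, fun V p hV hp => ?_⟩
    obtain ⟨t, ht⟩ := hP p fun a ha => hp a (by simp [ha])
    obtain ⟨φ, hφ, e⟩ := h₂ V p hV fun a ha => hp a (by simp [ha])
    refine ⟨_, .ball t hφ, fun v => ?_⟩
    simp only [Formula.realize_ballNum, ht, ← e, Fin.append_snoc]

theorem D0.exists_formula_of_sets {R : (Fin n → M.carrier) → Prop}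
    (hR : D0 M.sets R) : ∃ (k l : ℕ) (V : Fin k → Set M.carrier) (p : Fin l → M.carrier)
      (φ : Formula k (l + n)), (∀ i, V i ∈ M.sets) ∧ IsDelta00 φ ∧
        ∀ v, φ.Realize M V (Fin.append p v) ↔ R v := by
  obtain ⟨P, S, hS, h⟩ := hR.exists_formula
  obtain ⟨φ, hφ, e⟩ := h S.get P.get (fun s hs => List.get_of_mem hs)
    (fun s hs => List.get_of_mem hs)
  exact ⟨_, _, _, _, φ, fun i => hS _ (S.get_mem i), hφ, e⟩

theorem _root_.Fin.append_fin_one {α : Type*} (p : Fin l → α) (a : α) :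
    Fin.append p (fun _ : Fin 1 => a) = Fin.snoc (α := fun _ => α) p a := by
  rw [Fin.snoc_eq_append]
  congr 1
  funext i
  rw [Subsingleton.elim i 0]
  rfl

theorem Model.d0_induction (hM : ∀ θ ∈ delta00Induction, M.Satisfies θ) {P : M.carrier → Prop}
    (hP : D0 M.sets (fun v : Fin 1 → M.carrier => P (v 0))) (h0 : P 0)
    (hs : ∀ a, P a → P (a + 1)) (a : M.carrier) : P a := by
  obtain ⟨k, l, V, p, φ, hV, hφ, e⟩ := hP.exists_formula_of_sets
  have h := (Model.satisfies_inductionAxiom φ).1 (hM _ ⟨k, l, φ, hφ, rfl⟩) V hV p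
  have e' : ∀ a, φ.Realize M V (Fin.snoc (α := fun _ => M.carrier) p a) ↔ P a := fun a => by
    rw [← e (fun _ => a), Fin.append_fin_one]
  simp only [e'] at h
  exact h h0 hs a

theorem Model.d1_comprehension (hM : ∀ θ ∈ delta01Comprehension, M.Satisfies θ)
    {P Q : M.carrier → M.carrier → Prop}
    (hP : D0 M.sets (fun v : Fin 2 → M.carrier => P (v 0) (v 1)))
    (hQ : D0 M.sets (fun v : Fin 2 → M.carrier => Q (v 0) (v 1)))
    (h : ∀ a, (∃ b, P a b) ↔ ∀ b, Q a b) : {a | ∃ b, P a b} ∈ M.sets := by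
  obtain ⟨L, S, hS, h₁⟩ := hP.exists_formula
  obtain ⟨L', S', hS', h₂⟩ := hQ.exists_formula
  set V := (S ++ S').get
  set p := (L ++ L').get
  have hV : ∀ i, V i ∈ M.sets := fun i => by
    rcases List.mem_append.1 ((S ++ S').get_mem i) with h | h
    exacts [hS _ h, hS' _ h]
  obtain ⟨φ, hφ, e₁⟩ := h₁ V p (fun s hs => List.get_of_mem (by simp [hs]))
    (fun s hs => List.get_of_mem (by simp [hs]))
  obtain ⟨ψ, hψ, e₂⟩ := h₂ V p (fun s hs => List.get_of_mem (by simp [hs]))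
    (fun s hs => List.get_of_mem (by simp [hs]))
  have key : ∀ a b, Fin.snoc (α := fun _ => M.carrier) (Fin.snoc (α := fun _ => M.carrier) p a) b
      = Fin.append p ![a, b] := by
    intro a b
    rw [show ![a, b] = Fin.snoc (α := fun _ => M.carrier) (fun _ : Fin 1 => a) b from ?_,
      Fin.append_snoc, Fin.append_fin_one]
    funext i
    fin_cases i <;> rfl
  have := (Model.satisfies_comprehensionAxiom φ.exNum ψ.allNum).1
    (hM _ ⟨_, _, _, _, .ex (.delta hφ), .all (.delta hψ), rfl⟩) V hV p
  simp only [Formula.realize_exNum, Formula.realize_allNum, key, e₁, e₂] at this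
  exact this h

end Semantics
/-! ## The ordered semiring of a model -/

section PreArith

variable {N : Type u} [Zero N] [One N] [Add N] [Mul N] [LT N]

/-- The basic axioms and induction for bounded relations. -/
structure PreArith (X : Set (Set N)) : Prop where
  succ_ne_zero : ∀ x : N, x + 1 ≠ 0
  succ_inj : ∀ x y : N, x + 1 = y + 1 → x = y
  add_zero : ∀ x : N, x + 0 = x
  add_succ : ∀ x y : N, x + (y + 1) = x + y + 1
  mul_zero : ∀ x : N, x * 0 = 0
  mul_succ : ∀ x y : N, x * (y + 1) = x * y + x
  not_lt_zero : ∀ x : N, ¬ x < 0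
  lt_succ : ∀ x y : N, x < y + 1 ↔ x < y ∨ x = y
  ind : ∀ P : N → Prop, D0 X (fun v : Fin 1 → N => P (v 0)) → P 0 → (∀ x, P x → P (x + 1)) →
    ∀ x, P x

namespace PreArith

variable {X : Set (Set N)}

theorem zero_add (h : PreArith X) (x : N) : 0 + x = x :=
  h.ind (fun x => 0 + x = x) (.eq (.add (.const 0) (.var 0)) (.var 0)) (h.add_zero 0)
    (fun x ih => by rw [h.add_succ, ih]) x

theorem add_assoc (h : PreArith X) (x y z : N) : x + y + z = x + (y + z) :=
  h.ind (fun z => x + y + z = x + (y + z))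
    (.eq (.add (.const (x + y)) (.var 0)) (.add (.const x) (.add (.const y) (.var 0))))
    (by rw [h.add_zero, h.add_zero]) (fun z ih => by rw [h.add_succ, ih, h.add_succ, h.add_succ]) z

theorem succ_add (h : PreArith X) (x y : N) : x + 1 + y = x + y + 1 :=
  h.ind (fun y => x + 1 + y = x + y + 1)
    (.eq (.add (.const (x + 1)) (.var 0)) (.add (.add (.const x) (.var 0)) (.const 1)))
    (by rw [h.add_zero, h.add_zero]) (fun z ih => by rw [h.add_succ, ih, h.add_succ]) y

theorem add_comm (h : PreArith X) (x y : N) : x + y = y + x :=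
  h.ind (fun y => x + y = y + x) (.eq (.add (.const x) (.var 0)) (.add (.var 0) (.const x)))
    (by rw [h.add_zero, h.zero_add]) (fun z ih => by rw [h.add_succ, ih, h.succ_add]) y

theorem zero_mul (h : PreArith X) (x : N) : 0 * x = 0 :=
  h.ind (fun x => 0 * x = 0) (.eq (.mul (.const 0) (.var 0)) (.const 0)) (h.mul_zero 0)
    (fun x ih => by rw [h.mul_succ, ih, h.add_zero]) x

theorem mul_one (h : PreArith X) (x : N) : x * 1 = x := by
  rw [← h.zero_add 1, h.mul_succ, h.mul_zero, h.zero_add]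

theorem one_mul (h : PreArith X) (x : N) : 1 * x = x :=
  h.ind (fun x => 1 * x = x) (.eq (.mul (.const 1) (.var 0)) (.var 0)) (h.mul_zero 1)
    (fun x ih => by rw [h.mul_succ, ih]) x

theorem add_left_comm (h : PreArith X) (x y z : N) : x + (y + z) = y + (x + z) := by
  rw [← h.add_assoc, h.add_comm x y, h.add_assoc]

theorem mul_add (h : PreArith X) (x y z : N) : x * (y + z) = x * y + x * z :=
  h.ind (fun z => x * (y + z) = x * y + x * z)
    (.eq (.mul (.const x) (.add (.const y) (.var 0)))
      (.add (.const (x * y)) (.mul (.const x) (.var 0))))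
    (by rw [h.add_zero, h.mul_zero, h.add_zero])
    (fun z ih => by rw [h.add_succ, h.mul_succ, ih, h.mul_succ, h.add_assoc]) z

theorem add_mul (h : PreArith X) (x y z : N) : (x + y) * z = x * z + y * z :=
  h.ind (fun z => (x + y) * z = x * z + y * z)
    (.eq (.mul (.const (x + y)) (.var 0))
      (.add (.mul (.const x) (.var 0)) (.mul (.const y) (.var 0))))
    (by rw [h.mul_zero, h.mul_zero, h.mul_zero, h.add_zero])
    (fun z ih => by
      rw [h.mul_succ, ih, h.mul_succ, h.mul_succ, h.add_assoc, h.add_assoc, h.add_left_comm x]) z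

theorem mul_comm (h : PreArith X) (x y : N) : x * y = y * x :=
  h.ind (fun y => x * y = y * x) (.eq (.mul (.const x) (.var 0)) (.mul (.var 0) (.const x)))
    (by rw [h.mul_zero, h.zero_mul]) (fun z ih => by rw [h.mul_succ, ih, h.add_mul, h.one_mul]) y

theorem mul_assoc (h : PreArith X) (x y z : N) : x * y * z = x * (y * z) :=
  h.ind (fun z => x * y * z = x * (y * z))
    (.eq (.mul (.const (x * y)) (.var 0)) (.mul (.const x) (.mul (.const y) (.var 0))))
    (by rw [h.mul_zero, h.mul_zero, h.mul_zero])
    (fun z ih => by rw [h.mul_succ, ih, h.mul_succ, h.mul_add]) z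

theorem eq_zero_or_succ (h : PreArith X) (x : N) : x = 0 ∨ ∃ y, x = y + 1 := by
  -- So far bounded relations are only known to be closed under implication, falsity and bounded
  -- `∀`, so the disjunction is expressed by negations, with the predecessor bounded by `x`.
  have key := h.ind (fun x => (x = 0 → False) → (∀ y, y < x → (x = y + 1 → False)) → False)
    (.imp (.imp (.eq (.var 0) (.const 0)) .falsum) (.imp (.ball (.var 0) (.imp
      (.eq (.var 0) (.add (.var 1) (.const 1))) .falsum)) .falsum)) (fun h _ => h rfl)
    (fun x _ _ h' => h' x ((h.lt_succ x x).2 (.inr rfl)) rfl) x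
  by_contra! hx
  exact key hx.1 fun y _ => hx.2 y

/-- The semiring structure of a model. -/
abbrev commSemiring (h : PreArith X) : CommSemiring N where
  add_assoc := h.add_assoc
  zero_add := h.zero_add
  add_zero := h.add_zero
  add_comm := h.add_comm
  nsmul := nsmulRec
  left_distrib := h.mul_add
  right_distrib := h.add_mul
  zero_mul := h.zero_mul
  mul_zero := h.mul_zero
  mul_assoc := h.mul_assoc
  one_mul := h.one_mul
  mul_one := h.mul_one
  mul_comm := h.mul_comm

theorem lt_add_one (h : PreArith X) (x : N) : x < x + 1 := (h.lt_succ x x).2 (.inr rfl)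

theorem lt_trans (h : PreArith X) {x y z : N} (h₁ : x < y) (h₂ : y < z) : x < z :=
  h.ind (fun z => y < z → x < z) (.imp (.lt (.const y) (.var 0)) (.lt (.const x) (.var 0)))
    (fun h' => (h.not_lt_zero y h').elim)
    (fun z ih h' => (h.lt_succ _ _).2 <| .inl <| by
      rcases (h.lt_succ _ _).1 h' with h' | rfl
      exacts [ih h', h₁]) z h₂

theorem succ_lt_succ (h : PreArith X) {x y : N} (h₁ : x < y) : x + 1 < y + 1 :=
  h.ind (fun y => x < y → x + 1 < y + 1) (.imp (.lt (.const x) (.var 0))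
      (.lt (.const (x + 1)) (.add (.var 0) (.const 1))))
    (fun h' => (h.not_lt_zero x h').elim)
    (fun z ih h' => (h.lt_succ _ _).2 <| by
      rcases (h.lt_succ _ _).1 h' with h' | rfl
      exacts [.inl (ih h'), .inr rfl]) y h₁

theorem lt_irrefl (h : PreArith X) (x : N) : ¬ x < x :=
  h.ind (fun x => x < x → False) (.imp (.lt (.var 0) (.var 0)) .falsum)
    (h.not_lt_zero 0) (fun x ih h' => ih <| by
      rcases (h.lt_succ _ _).1 h' with h' | h'
      · exact h.lt_trans (h.lt_add_one x) h'
      · have := h.lt_add_one x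
        rwa [h'] at this) x

theorem zero_lt_or (h : PreArith X) (x : N) : 0 < x ∨ 0 = x := by
  have := h.ind (fun x => (0 < x → False) → 0 = x)
    (.imp (.imp (.lt (.const 0) (.var 0)) .falsum) (.eq (.const 0) (.var 0)))
    (fun _ => rfl) (fun x ih h' => (h' <| (h.lt_succ _ _).2 <| by tauto).elim) x
  tauto

theorem trichotomy (h : PreArith X) (x y : N) : x < y ∨ x = y ∨ y < x := by
  have := h.ind (fun y => (x < y → False) → (x = y → False) → y < x)
    (.imp (.imp (.lt (.const x) (.var 0)) .falsum) (.imp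
      (.imp (.eq (.const x) (.var 0)) .falsum) (.lt (.var 0) (.const x))))
    (fun h₁ h₂ => (h.zero_lt_or x).resolve_right fun h => h₂ h.symm)
    (fun y ih h₁ h₂ => by
      have h₃ : y < x := ih (fun h' => h₁ ((h.lt_succ _ _).2 (.inl h')))
        (fun h' => h₁ ((h.lt_succ _ _).2 (.inr h')))
      rcases h.eq_zero_or_succ x with rfl | ⟨z, rfl⟩
      · exact (h.not_lt_zero _ h₃).elim
      · rcases (h.lt_succ _ _).1 h₃ with h' | rfl
        exacts [h.succ_lt_succ h', (h₂ rfl).elim]) y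
  tauto

theorem add_lt_add_right (h : PreArith X) {x y : N} (h₁ : x < y) (z : N) : x + z < y + z :=
  h.ind (fun z => x + z < y + z) (.lt (.add (.const x) (.var 0)) (.add (.const y) (.var 0)))
    (by simpa only [h.add_zero] using h₁)
    (fun z ih => by simpa only [h.add_succ] using h.succ_lt_succ ih) z

theorem exists_add_of_lt (h : PreArith X) {x y : N} (h₁ : x < y) : ∃ z, y = x + z := by
  -- The bound `z < y` makes the claim `Δ⁰₀`. It excludes the difference only if `x = 0`, where the
  -- difference is `y` itself.
  have key := h.ind (fun y => x < y → (∀ z, z < y → (y = x + z → False)) → x = 0)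
    (.imp (.lt (.const x) (.var 0)) (.imp (.ball (.var 0) (.imp
      (.eq (.var 0) (.add (.const x) (.var 1))) .falsum)) (.eq (.const x) (.const 0))))
    (fun h' => (h.not_lt_zero x h').elim)
    (fun y ih h₁ h₂ => by
      rcases (h.lt_succ _ _).1 h₁ with h' | rfl
      · refine ih h' fun z hz e => h₂ (z + 1) (h.succ_lt_succ hz) ?_
        rw [h.add_succ, ← e]
      · by_contra h0
        refine h₂ 1 ?_ rfl
        rcases h.zero_lt_or x with h' | h'
        · simpa only [h.zero_add] using h.succ_lt_succ h'
        · exact (h0 h'.symm).elim) y h₁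
  by_contra! h'
  refine h' y ?_
  rw [key fun z _ e => h' z e, h.zero_add]

open Classical in
/-- The order of a model. -/
noncomputable abbrev linearOrder (h : PreArith X) : LinearOrder N where
  lt := (· < ·)
  le x y := x < y ∨ x = y
  le_refl x := .inr rfl
  le_trans x y z := by
    rintro (h₁ | rfl) (h₂ | rfl)
    exacts [.inl (h.lt_trans h₁ h₂), .inl h₁, .inl h₂, .inr rfl]
  lt_iff_le_not_ge x y := by
    constructor
    · intro h₁
      refine ⟨.inl h₁, ?_⟩
      rintro (h₂ | rfl)
      exacts [h.lt_irrefl _ (h.lt_trans h₁ h₂), h.lt_irrefl _ h₁]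
    · rintro ⟨h₁ | rfl, h₂⟩
      exacts [h₁, (h₂ (.inr rfl)).elim]
  le_antisymm x y := by
    rintro (h₁ | rfl) (h₂ | h₂)
    exacts [(h.lt_irrefl _ (h.lt_trans h₁ h₂)).elim, h₂.symm, rfl, rfl]
  le_total x y := by
    rcases h.trichotomy x y with h | h | h
    exacts [.inl (.inl h), .inl (.inr h), .inr (.inl h)]
  toDecidableLE := Classical.decRel _

theorem mul_pos (h : PreArith X) {x y : N} (hx : 0 < x) (hy : 0 < y) : 0 < x * y := by
  rcases h.eq_zero_or_succ x with rfl | ⟨x, rfl⟩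
  · exact (h.lt_irrefl _ hx).elim
  rcases h.eq_zero_or_succ y with rfl | ⟨y, rfl⟩
  · exact (h.lt_irrefl _ hy).elim
  rw [h.mul_succ, h.add_succ]
  exact (h.lt_succ _ _).2 (h.zero_lt_or _)

theorem mul_lt_mul_left (h : PreArith X) {x y z : N} (hz : 0 < z) (h₁ : x < y) :
    z * x < z * y := by
  obtain ⟨w, rfl⟩ := h.exists_add_of_lt h₁
  rcases h.zero_lt_or w with hw | rfl
  · have := h.add_lt_add_right (h.mul_pos hz hw) (z * x)
    rwa [h.zero_add, h.add_comm, ← h.mul_add] at this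
  · rw [h.add_zero] at h₁
    exact (h.lt_irrefl _ h₁).elim

theorem isStrictOrderedRing (h : PreArith X) :
    letI := h.commSemiring
    letI := h.linearOrder
    IsStrictOrderedRing N := by
  let := h.commSemiring
  let := h.linearOrder
  have h1 : ∀ x y z : N, x < y → x + z < y + z := fun x y z h' => h.add_lt_add_right h' z
  have hle : ∀ x y z : N, x ≤ y → x + z ≤ y + z := fun x y z h' => by
    rcases h'.lt_or_eq with h' | rfl
    exacts [(h1 _ _ _ h').le, le_rfl]
  refine
    { add_le_add_left := fun x y h' z => hle x y z h'
      le_of_add_le_add_left := fun x y z h' => ?_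
      zero_le_one := ?_
      exists_pair_ne := ⟨0, 1, ?_⟩
      mul_lt_mul_of_pos_left := fun z hz x y h' => h.mul_lt_mul_left hz h'
      mul_lt_mul_of_pos_right := fun z hz x y h' => by
        rw [h.mul_comm x, h.mul_comm y]
        exact h.mul_lt_mul_left hz h' }
  · by_contra! h''
    have := h1 _ _ x h''
    rw [h.add_comm z, h.add_comm y] at this
    exact absurd h' this.not_ge
  · have := h.lt_add_one 0
    rw [h.zero_add] at this
    exact this.le
  · have := h.succ_ne_zero 0
    rw [h.zero_add] at this
    exact this.symm

theorem canonicallyOrderedAdd (h : PreArith X) :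
    letI := h.commSemiring
    letI := h.linearOrder
    CanonicallyOrderedAdd N := by
  let := h.commSemiring
  let := h.linearOrder
  have := h.isStrictOrderedRing
  have h0 : ∀ x : N, 0 ≤ x := fun x => h.zero_lt_or x
  refine { exists_add_of_le := ?_, le_self_add := ?_, le_add_self := ?_ }
  · rintro x y (h' | rfl)
    exacts [h.exists_add_of_lt h', ⟨0, (h.add_zero _).symm⟩]
  · exact fun x y => le_add_of_nonneg_left (h0 y)
  · exact fun x y => le_add_of_nonneg_right (h0 y)

end PreArith

end PreArith

/-! ## Functions with bounded graph -/

/-- Discretely ordered semirings with least element `0`. -/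
class IsDiscretelyOrdered (N : Type u) [CommSemiring N] [LinearOrder N] : Prop extends
    IsStrictOrderedRing N, CanonicallyOrderedAdd N where
  lt_add_one_iff' : ∀ {x y : N}, x < y + 1 ↔ x ≤ y

section BoundedFun

variable {N : Type u} [CommSemiring N] [LinearOrder N] [IsDiscretelyOrdered N] {n m : ℕ}

theorem lt_succ_iff {x y : N} : x < y + 1 ↔ x ≤ y := IsDiscretelyOrdered.lt_add_one_iff'

theorem succ_le_iff {x y : N} : x + 1 ≤ y ↔ x < y := by
  rw [← not_lt, lt_succ_iff, not_le]

theorem eq_zero_or_succ (x : N) : x = 0 ∨ ∃ y, x = y + 1 := by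
  rcases (zero_le (a := x)).eq_or_lt with h | h
  · exact .inl h.symm
  · rw [← succ_le_iff, zero_add] at h
    obtain ⟨y, rfl⟩ := exists_add_of_le h
    exact .inr ⟨y, add_comm _ _⟩

variable {X : Set (Set N)} {R S : (Fin n → N) → Prop} {f g h : (Fin n → N) → N}

theorem D0.congr (hR : D0 X R) (e : ∀ v, S v ↔ R v) : D0 X S := by
  rwa [show S = R from funext fun v => propext (e v)]

theorem D0.not (hR : D0 X R) : D0 X (fun v => ¬ R v) := hR.imp .falsum

theorem D0.and (hR : D0 X R) (hS : D0 X S) : D0 X (fun v => R v ∧ S v) :=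
  (hR.imp hS.not).not.congr fun v => by tauto

theorem D0.or (hR : D0 X R) (hS : D0 X S) : D0 X (fun v => R v ∨ S v) :=
  (hR.not.imp hS).congr fun v => by tauto

theorem D0.iff (hR : D0 X R) (hS : D0 X S) : D0 X (fun v => R v ↔ S v) :=
  ((hR.imp hS).and (hS.imp hR)).congr fun v => by tauto

/-- Functions with bounded graph and polynomial bound. -/
def F0 (X : Set (Set N)) (f : (Fin n → N) → N) : Prop :=
  ∃ t, PolyFun t ∧ (∀ v, f v ≤ t v) ∧
    D0 X (fun v : Fin (n + 1) → N => v (Fin.last n) = f (Fin.init v))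

theorem PolyFun.f0 (hf : PolyFun f) : F0 X f :=
  ⟨f, hf, fun _ => le_rfl, .eq (.var _) hf.wk⟩

theorem F0.var (i : Fin n) : F0 X (fun v : Fin n → N => v i) := (PolyFun.var i).f0

theorem F0.last : F0 X (fun v : Fin (n + 1) → N => v (Fin.last n)) := F0.var _

theorem F0.const (c : N) : F0 X (fun _ : Fin n → N => c) := (PolyFun.const c).f0

theorem F0.wk (hf : F0 X f) : F0 X (fun v : Fin (n + 1) → N => f (Fin.init v)) := by
  obtain ⟨t, ht, h₁, h₂⟩ := hf
  refine ⟨_, ht.wk, fun v => h₁ _, ?_⟩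
  have := h₂.subst (m := n + 2) (σ := Fin.snoc (α := fun _ => (Fin (n + 2) → N) → N)
    (fun i v => v i.castSucc.castSucc) (fun v => v (Fin.last _))) fun i => by
      refine Fin.lastCases ?_ (fun i => ?_) i
      · simpa using .var _
      · simpa using .var _
  refine this.congr fun v => ?_
  simp [Fin.init_def]

/-- `R` holds at the value of `f` if and only if some `a` below the polynomial bound is this value
and satisfies `R`. This is what allows substitution of functions that are not terms. -/
theorem D0.comp_last {R : (Fin (n + 1) → N) → Prop} (hR : D0 X R) (hf : F0 X f) :
    D0 X (fun v => R (Fin.snoc (α := fun _ => N) v (f v))) := by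
  obtain ⟨t, ht, h₁, h₂⟩ := hf
  refine (D0.not (.ball (ht.add (.const 1)) (h₂.and hR).not)).congr fun v => ?_
  simp only [Fin.snoc_last, Fin.init_snoc, not_forall, not_not]
  exact ⟨fun h => ⟨_, lt_succ_iff.2 (h₁ v), rfl, h⟩, fun ⟨a, _, ha, h⟩ => ha ▸ h⟩

theorem D0.eq' (hf : F0 X f) (hg : F0 X g) : D0 X (fun v => f v = g v) :=
  (hg.choose_spec.2.2.comp_last hf).congr fun v => by simp

theorem D0.lt' (hf : F0 X f) (hg : F0 X g) : D0 X (fun v => f v < g v) := by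
  have h : D0 X (fun v : Fin (n + 2) → N => v (Fin.last n).castSucc < v (Fin.last _)) :=
    .lt (.var _) (.var _)
  refine ((h.comp_last hg.wk).comp_last hf).congr fun v => ?_
  rw [Fin.snoc_castSucc, Fin.snoc_last, Fin.snoc_last, Fin.init_snoc]

theorem D0.le (hf : F0 X f) (hg : F0 X g) : D0 X (fun v => f v ≤ g v) :=
  (D0.lt' hg hf).not.congr fun v => by simp

theorem D0.mem' {A : Set N} (hA : A ∈ X) (hf : F0 X f) : D0 X (fun v => f v ∈ A) := by
  have h : D0 X (fun v : Fin (n + 1) → N => v (Fin.last _) ∈ A) := .mem hA (.var _)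
  exact (h.comp_last hf).congr fun v => by simp

theorem D0.all {R : (Fin n → N) → N → Prop} (hf : F0 X f)
    (hR : D0 X (fun v : Fin (n + 1) → N => R (Fin.init v) (v (Fin.last n)))) :
    D0 X (fun v => ∀ a, a < f v → R v a) := by
  -- `D0.ball` accepts polynomial bounds only, so the bound is at first a variable, for which `f` is
  -- substituted afterwards.
  have h : D0 X (fun v : Fin (n + 1) → N => ∀ a, a < v (Fin.last n) → R (Fin.init v) a) := by
    have h' := hR.subst (m := n + 2) (σ := Fin.snoc (α := fun _ => (Fin (n + 2) → N) → N)
      (fun i v => v i.castSucc.castSucc) (fun v => v (Fin.last _))) fun i => by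
        refine Fin.lastCases ?_ (fun i => ?_) i
        · simpa using .var _
        · simpa using .var _
    refine (D0.ball (.var (Fin.last n)) h').congr fun v => ?_
    simp [Fin.init_def]
  exact (h.comp_last hf).congr fun v => by simp

theorem D0.ex {R : (Fin n → N) → N → Prop} (hf : F0 X f)
    (hR : D0 X (fun v : Fin (n + 1) → N => R (Fin.init v) (v (Fin.last n)))) :
    D0 X (fun v => ∃ a, a < f v ∧ R v a) :=
  (D0.all (R := fun v a => ¬ R v a) hf hR.not).not.congr fun v => by simp

theorem F0.of_le {t : (Fin n → N) → N} (ht : F0 X t) (hle : ∀ v, f v ≤ t v)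
    (hf : D0 X (fun v : Fin (n + 1) → N => v (Fin.last n) = f (Fin.init v))) : F0 X f := by
  obtain ⟨s, hs, h, -⟩ := ht
  exact ⟨s, hs, fun v => (hle v).trans (h v), hf⟩

theorem F0.add (hf : F0 X f) (hg : F0 X g) : F0 X (fun v => f v + g v) := by
  obtain ⟨s, hs, h, -⟩ := id hf
  obtain ⟨t, ht, h', -⟩ := id hg
  refine ⟨_, hs.add ht, fun v => add_le_add (h v) (h' v), ?_⟩
  have : D0 X (fun v : Fin (n + 3) → N =>
    v (Fin.last n).castSucc.castSucc = v (Fin.last _) + v (Fin.last _).castSucc) :=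
    .eq (.var _) (.add (.var _) (.var _))
  exact ((this.comp_last hf.wk.wk).comp_last hg.wk).congr fun v => by simp

theorem F0.mul (hf : F0 X f) (hg : F0 X g) : F0 X (fun v => f v * g v) := by
  obtain ⟨s, hs, h, -⟩ := id hf
  obtain ⟨t, ht, h', -⟩ := id hg
  refine ⟨_, hs.mul ht, fun v => mul_le_mul' (h v) (h' v), ?_⟩
  have : D0 X (fun v : Fin (n + 3) → N =>
    v (Fin.last n).castSucc.castSucc = v (Fin.last _) * v (Fin.last _).castSucc) :=
    .eq (.var _) (.mul (.var _) (.var _))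
  exact ((this.comp_last hf.wk.wk).comp_last hg.wk).congr fun v => by simp

theorem F0.succ (hf : F0 X f) : F0 X (fun v => f v + 1) := hf.add (.const 1)

theorem D0.all_le {R : (Fin n → N) → N → Prop} (hf : F0 X f)
    (hR : D0 X (fun v : Fin (n + 1) → N => R (Fin.init v) (v (Fin.last n)))) :
    D0 X (fun v => ∀ a, a ≤ f v → R v a) :=
  (D0.all hf.succ hR).congr fun v => by simp [lt_succ_iff]

theorem D0.ex_le {R : (Fin n → N) → N → Prop} (hf : F0 X f)
    (hR : D0 X (fun v : Fin (n + 1) → N => R (Fin.init v) (v (Fin.last n)))) :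
    D0 X (fun v => ∃ a, a ≤ f v ∧ R v a) :=
  (D0.ex hf.succ hR).congr fun v => by simp [lt_succ_iff]

theorem F0.poly_comp {t : (Fin n → N) → N} (ht : PolyFun t) {σ : Fin n → (Fin m → N) → N}
    (hσ : ∀ i, F0 X (σ i)) : F0 X (fun v => t fun i => σ i v) := by
  induction ht generalizing m with
  | var i => exact hσ i
  | const c => exact .const c
  | add _ _ ih₁ ih₂ => exact (ih₁ hσ).add (ih₂ hσ)
  | mul _ _ ih₁ ih₂ => exact (ih₁ hσ).mul (ih₂ hσ)

theorem D0.comp (hR : D0 X R) {σ : Fin n → (Fin m → N) → N} (hσ : ∀ i, F0 X (σ i)) :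
    D0 X (fun v => R fun i => σ i v) := by
  induction hR generalizing m with
  | eq hs ht => exact .eq' (.poly_comp hs hσ) (.poly_comp ht hσ)
  | lt hs ht => exact .lt' (.poly_comp hs hσ) (.poly_comp ht hσ)
  | mem hA hs => exact .mem' hA (.poly_comp hs hσ)
  | falsum => exact .falsum
  | imp _ _ ih₁ ih₂ => exact .imp (ih₁ hσ) (ih₂ hσ)
  | @ball n t R ht _ ih =>
    refine D0.all (.poly_comp ht hσ) ?_
    have key : ∀ i : Fin (n + 1), F0 X (Fin.snoc (α := fun _ => (Fin (m + 1) → N) → N)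
        (fun i v => σ i (Fin.init v)) (fun v => v (Fin.last m)) i) := by
      intro i
      refine Fin.lastCases ?_ (fun i => ?_) i
      · simpa using F0.last
      · simpa using (hσ i).wk
    refine (ih key).congr fun v => ?_
    congr! 1
    funext i
    refine Fin.lastCases ?_ (fun i => ?_) i <;> simp

theorem D0.comp₁ {P : N → Prop} (hP : D0 X (fun v : Fin 1 → N => P (v 0))) (hf : F0 X f) :
    D0 X (fun v => P (f v)) :=
  hP.comp (σ := ![f]) (by simp [hf])

theorem D0.comp₂ {P : N → N → Prop} (hP : D0 X (fun v : Fin 2 → N => P (v 0) (v 1)))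
    (hf : F0 X f) (hg : F0 X g) : D0 X (fun v => P (f v) (g v)) :=
  hP.comp (σ := ![f, g]) (by simp [Fin.forall_fin_succ, hf, hg])

/-- A unary function with bounded graph, composed with another one. -/
theorem F0.comp₁ {F : N → N} (hF : D0 X (fun v : Fin 2 → N => v 0 = F (v 1)))
    (hle : ∀ x, F x ≤ x) (hf : F0 X f) : F0 X (fun v => F (f v)) :=
  .of_le hf (fun _ => hle _) (hF.comp₂ (P := fun a b => a = F b) .last hf.wk)

theorem F0.ite [∀ v, Decidable (R v)] (hR : D0 X R) (hf : F0 X f) (hg : F0 X g) :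
    F0 X (fun v => if R v then f v else g v) := by
  refine .of_le (hf.add hg) (fun v => ?_) ?_
  · split_ifs <;> simp
  · have hR' : D0 X (fun v : Fin (n + 1) → N => R (Fin.init v)) := hR.wk
    refine ((hR'.and (.eq' .last hf.wk)).or (hR'.not.and (.eq' .last hg.wk))).congr fun v => ?_
    split_ifs <;> simp_all

theorem D0.dvd (hf : F0 X f) (hg : F0 X g) : D0 X (fun v => f v ∣ g v) := by
  refine (D0.ex_le (R := fun v a => g v = f v * a) hg (.eq' hg.wk (hf.wk.mul .last))).congr
    fun v => ⟨?_, fun ⟨a, _, h⟩ => ⟨a, h⟩⟩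
  rintro ⟨a, h⟩
  rcases eq_zero_or_succ (f v) with h0 | ⟨y, hy⟩
  -- A given quotient by zero may exceed the bound; it is replaced by `0`.
  · exact ⟨0, zero_le, by simp [h, h0]⟩
  · refine ⟨a, ?_, h⟩
    rw [h, hy, add_mul, one_mul]
    exact le_add_self

/-! ### Pairing -/

/-- An injective pairing function. -/
def pair (x y : N) : N := (x + y) * (x + y) + x

/-- `pair x y` lies in the interval from `(x + y)²` up to, but excluding, `(x + y + 1)²`, so it
determines `x + y` and then `x`. -/
theorem pair_inj {x y x' y' : N} (h : pair x y = pair x' y') : x = x' ∧ y = y' := by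
  have key : ∀ {x y x' y' : N}, pair x y = pair x' y' → ¬ x + y < x' + y' := by
    intro x y x' y' h hlt
    rw [← succ_le_iff] at hlt
    have h₁ : pair x' y' < (x + y + 1) * (x + y + 1) := by
      rw [← h, pair, show (x + y + 1) * (x + y + 1) = (x + y) * (x + y) + (x + (x + y + y + 1)) by
        ring]
      exact add_lt_add_right (lt_add_of_pos_right _ (lt_succ_iff.2 zero_le)) _
    have h₂ : (x + y + 1) * (x + y + 1) ≤ pair x' y' :=
      (mul_le_mul' hlt hlt).trans le_self_add
    exact absurd h₁ h₂.not_gt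
  have e : x + y = x' + y' := le_antisymm (not_lt.1 (key h.symm)) (not_lt.1 (key h))
  have hx : x = x' := by
    rw [pair, pair, e] at h
    exact add_left_cancel h
  subst hx
  exact ⟨rfl, add_left_cancel e⟩

theorem le_pair_left (x y : N) : x ≤ pair x y := le_add_self

theorem le_mul_self' (x : N) : x ≤ x * x := by
  rcases eq_zero_or_succ x with rfl | ⟨y, rfl⟩
  · simp
  · rw [mul_add, mul_one]
    exact le_add_self

theorem le_pair_right (x y : N) : y ≤ pair x y :=
  (le_add_self.trans (le_mul_self' (x + y))).trans le_self_add

open Classical in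
/-- The first component of a pair. -/
noncomputable def left (z : N) : N := if h : ∃ x y, z = pair x y then h.choose else 0

open Classical in
/-- The second component of a pair. -/
noncomputable def right (z : N) : N := if h : ∃ x y, z = pair x y then h.choose_spec.choose else 0

@[simp] theorem left_pair (x y : N) : left (pair x y) = x := by
  have h : ∃ a b, pair x y = pair a b := ⟨x, y, rfl⟩
  rw [left, dif_pos h]
  exact (pair_inj h.choose_spec.choose_spec).1.symm

@[simp] theorem right_pair (x y : N) : right (pair x y) = y := by
  have h : ∃ a b, pair x y = pair a b := ⟨x, y, rfl⟩
  rw [right, dif_pos h]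
  exact (pair_inj h.choose_spec.choose_spec).2.symm

theorem left_le (z : N) : left z ≤ z := by
  by_cases h : ∃ x y, z = pair x y
  · obtain ⟨x, y, rfl⟩ := h
    simpa using le_pair_left x y
  · simp [left, h]

theorem right_le (z : N) : right z ≤ z := by
  by_cases h : ∃ x y, z = pair x y
  · obtain ⟨x, y, rfl⟩ := h
    simpa using le_pair_right x y
  · simp [right, h]

theorem F0.pair (hf : F0 X f) (hg : F0 X g) : F0 X (fun v => pair (f v) (g v)) :=
  ((hf.add hg).mul (hf.add hg)).add hf

theorem F0.left (hf : F0 X f) : F0 X (fun v => left (f v)) := by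
  refine .comp₁ ?_ left_le hf
  -- The second disjunct covers the numbers that are not pairs, where the value is `0` by default.
  refine ((D0.ex_le (R := fun v y => v 1 = SecondOrderArith.pair (v 0) y) (.var 1)
    (.eq' (.var _) (F0.pair (.var _) .last))).or (.and (.eq' (.var 0) (.const 0))
      (D0.all_le (R := fun v x => ∀ y, y ≤ v 1 → v 1 = SecondOrderArith.pair x y → False) (.var 1)
        (D0.all_le (R := fun v y => v 1 = SecondOrderArith.pair (v 2) y → False) (.var 1)
          ((D0.eq' (.var _) (F0.pair (.var _) .last)).imp .falsum))))).congr fun v => ?_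
  by_cases h : ∃ x y, v 1 = SecondOrderArith.pair x y
  · obtain ⟨x, y, h⟩ := h
    simp only [h, left_pair]
    constructor
    · intro h
      exact .inl ⟨y, le_pair_right x y, by rw [h]⟩
    · rintro (⟨a, _, h⟩ | ⟨_, h⟩)
      · exact (pair_inj h).1.symm
      · exact (h x (le_pair_left x y) y (le_pair_right x y) rfl).elim
  · have h0 : SecondOrderArith.left (v 1) = 0 := by simp [SecondOrderArith.left, h]
    rw [h0]
    exact ⟨fun h' => .inr ⟨h', fun x _ y _ e => h ⟨x, y, e⟩⟩,
      fun h' => h'.elim (fun ⟨y, _, e⟩ => (h ⟨_, y, e⟩).elim) And.left⟩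

theorem F0.right (hf : F0 X f) : F0 X (fun v => right (f v)) := by
  refine .comp₁ ?_ right_le hf
  refine ((D0.ex_le (R := fun v y => v 1 = SecondOrderArith.pair y (v 0)) (.var 1)
    (.eq' (.var _) (F0.pair .last (.var _)))).or (.and (.eq' (.var 0) (.const 0))
      (D0.all_le (R := fun v x => ∀ y, y ≤ v 1 → v 1 = SecondOrderArith.pair x y → False) (.var 1)
        (D0.all_le (R := fun v y => v 1 = SecondOrderArith.pair (v 2) y → False) (.var 1)
          ((D0.eq' (.var _) (F0.pair (.var _) .last)).imp .falsum))))).congr fun v => ?_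
  by_cases h : ∃ x y, v 1 = SecondOrderArith.pair x y
  · obtain ⟨x, y, h⟩ := h
    simp only [h, right_pair]
    constructor
    · intro h
      exact .inl ⟨x, le_pair_left x y, by rw [h]⟩
    · rintro (⟨a, _, h⟩ | ⟨_, h⟩)
      · exact (pair_inj h).2.symm
      · exact (h x (le_pair_left x y) y (le_pair_right x y) rfl).elim
  · have h0 : SecondOrderArith.right (v 1) = 0 := by simp [SecondOrderArith.right, h]
    rw [h0]
    exact ⟨fun h' => .inr ⟨h', fun x _ y _ e => h ⟨x, y, e⟩⟩,
      fun h' => h'.elim (fun ⟨y, _, e⟩ => (h ⟨y, _, e⟩).elim) And.left⟩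

end BoundedFun

/-! ## Arithmetic in models of `RCA*₀` -/

section Arith

variable {N : Type u} [CommSemiring N] [LinearOrder N]

/-- `c` is the remainder of `a` modulo `1 + (i + 1) * b`. -/
def Beta (a b i c : N) : Prop := c < 1 + (i + 1) * b ∧ ∃ q, a = q * (1 + (i + 1) * b) + c

/-- `a, b` code a sequence that witnesses `2 ^ x = y`. -/
def ExpSeq (a b x y : N) : Prop :=
  Beta a b 0 1 ∧ (∀ i, i < x → ∃ c, Beta a b i c ∧ Beta a b (i + 1) (c + c)) ∧ Beta a b x y

/-- The semantic content of `RCA*₀` over an ordered semiring. -/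
class Arith (X : Set (Set N)) : Prop where
  ind : ∀ P : N → Prop, D0 X (fun v : Fin 1 → N => P (v 0)) → P 0 → (∀ x, P x → P (x + 1)) →
    ∀ x, P x
  comprehension : ∀ P Q : N → N → Prop, D0 X (fun v : Fin 2 → N => P (v 0) (v 1)) →
    D0 X (fun v : Fin 2 → N => Q (v 0) (v 1)) → (∀ a, (∃ b, P a b) ↔ ∀ b, Q a b) →
    {a | ∃ b, P a b} ∈ X
  exp : ∀ x : N, ∃ y a b, ExpSeq a b x y

variable [IsDiscretelyOrdered N] {X : Set (Set N)} [Arith X] {n : ℕ} {f g h k : (Fin n → N) → N}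

theorem ind {P : N → Prop} (hP : D0 X (fun v : Fin 1 → N => P (v 0))) (h0 : P 0)
    (hs : ∀ x, P x → P (x + 1)) (x : N) : P x := Arith.ind P hP h0 hs x

theorem strong_ind {P : N → Prop} (hP : D0 X (fun v : Fin 1 → N => P (v 0)))
    (hs : ∀ x, (∀ y, y < x → P y) → P x) (x : N) : P x := by
  refine hs x (ind (P := fun x => ∀ y, y < x → P y) (X := X)
    (.all (.var 0) (.comp₁ hP .last)) (fun y hy => (not_lt_zero hy).elim) (fun x ih y hy => ?_) x)
  rcases (lt_succ_iff.1 hy).eq_or_lt with rfl | hy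
  exacts [hs _ ih, ih y hy]

theorem exists_least {P : N → Prop} (hP : D0 X (fun v : Fin 1 → N => P (v 0))) {a : N}
    (ha : P a) : ∃ x, P x ∧ ∀ y, y < x → ¬ P y := by
  by_contra! h
  refine strong_ind (P := fun x => ¬ P x) hP.not (fun x ih hx => ?_) a ha
  obtain ⟨y, hy, hy'⟩ := h x hx
  exact ih y hy hy'

theorem setOf_mem {P : N → Prop} (hP : D0 X (fun v : Fin 1 → N => P (v 0))) : {a | P a} ∈ X := by
  have := Arith.comprehension (X := X) (fun a _ => P a) (fun a _ => P a)
    (.comp₁ hP (.var 0)) (.comp₁ hP (.var 0)) (fun a => by simp [exists_const])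
  simpa using this

/-- The collection principle for bounded relations. -/
theorem collection {R : N → N → Prop} (hR : D0 X (fun v : Fin 2 → N => R (v 0) (v 1))) (n : N)
    (h : ∀ i, i < n → ∃ y, R i y) : ∃ b, ∀ i, i < n → ∃ y, y ≤ b ∧ R i y := by
  by_contra! hb
  have hleast : ∀ i, i < n → ∃ y, R i y ∧ ∀ z, z < y → ¬ R i z := fun i hi => by
    obtain ⟨y, hy⟩ := h i hi
    exact exists_least (P := fun y => R i y) (.comp₂ hR (.const i) (.var 0)) hy
  -- Let `μ(i)` be the least witness for `i`. For components of `z` below `n`, both `∃ y, P z y` and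
  -- `∀ y, Q z y` say that `μ(left z) ≤ μ(right z)`. So this comparison of least witnesses is a
  -- `Δ⁰₁` set `S`.
  let P : N → N → Prop := fun z y => left z < n ∧ right z < n ∧
    (∃ y', y' ≤ y ∧ R (left z) y') ∧ ∀ y', y' < y → ¬ R (right z) y'
  let Q : N → N → Prop := fun z y => left z < n ∧ right z < n ∧
    ((∃ y', y' ≤ y ∧ R (right z) y') → ∃ y', y' ≤ y ∧ R (left z) y')
  have hP : D0 X (fun v : Fin 2 → N => P (v 0) (v 1)) :=
    .and (.lt' (.left (.var 0)) (.const n)) (.and (.lt' (.right (.var 0)) (.const n)) (.and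
      (.ex_le (R := fun v y' => R (left (v 0)) y') (.var 1) (.comp₂ hR (.left (.var _)) .last))
      (.all (R := fun v y' => ¬ R (right (v 0)) y') (.var 1)
        (D0.comp₂ hR (.right (.var _)) .last).not)))
  have hQ : D0 X (fun v : Fin 2 → N => Q (v 0) (v 1)) :=
    .and (.lt' (.left (.var 0)) (.const n)) (.and (.lt' (.right (.var 0)) (.const n)) (.imp
      (.ex_le (R := fun v y' => R (right (v 0)) y') (.var 1) (.comp₂ hR (.right (.var _)) .last))
      (.ex_le (R := fun v y' => R (left (v 0)) y') (.var 1) (.comp₂ hR (.left (.var _)) .last))))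
  have hS := Arith.comprehension P Q hP hQ fun z => by
    constructor
    · rintro ⟨y, h₁, h₂, ⟨y₁, hy₁, hR₁⟩, h₃⟩ y'
      refine ⟨h₁, h₂, ?_⟩
      rintro ⟨y₂, hy₂, hR₂⟩
      exact ⟨y₁, hy₁.trans ((not_lt.1 fun hlt => h₃ _ hlt hR₂).trans hy₂), hR₁⟩
    · intro hz
      obtain ⟨h₁, h₂, -⟩ := hz 0
      obtain ⟨y, hy, hy'⟩ := hleast _ h₂
      exact ⟨y, h₁, h₂, (hz y).2.2 ⟨y, le_rfl, hy⟩, hy'⟩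
  set S := {z | ∃ y, P z y}
  have hmem : ∀ i j, i < n → j < n → (pair i j ∈ S ↔ ∀ y, R j y → ∃ y', y' ≤ y ∧ R i y') := by
    intro i j hi hj
    simp only [S, P, Set.mem_ofPred_eq, left_pair, right_pair]
    constructor
    · rintro ⟨y, -, -, ⟨y₁, hy₁, hR₁⟩, h₃⟩ y₂ hR₂
      exact ⟨y₁, hy₁.trans (not_lt.1 fun hlt => h₃ _ hlt hR₂), hR₁⟩
    · intro h'
      obtain ⟨y, hy, hy'⟩ := hleast _ hj
      exact ⟨y, hi, hj, h' y hy, hy'⟩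
  -- With `S` as a parameter, induction finds an index whose least witness is the largest. Any
  -- witness for that index then bounds suitable witnesses for all the others.
  have hmax : ∀ m, m ≤ n → 0 < m → ∃ i, i < m ∧ ∀ j, j < m → pair j i ∈ S := by
    refine ind (X := X) (.imp (.le (.var 0) (.const n)) (.imp (.lt' (.const 0) (.var 0))
      (.ex (.var 0) (.all (R := fun v j => pair j (v 1) ∈ S) (.var 0)
        (.mem' hS (.pair .last (.var _))))))) (fun _ h0 => (lt_irrefl _ h0).elim) ?_
    intro m ih hm _
    have hmn : m < n := succ_le_iff.1 hm
    rcases (zero_le (a := m)).eq_or_lt with rfl | hm0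
    · refine ⟨0, by simp, fun j hj => ?_⟩
      obtain rfl : j = 0 := le_antisymm (lt_succ_iff.1 hj) zero_le
      exact (hmem _ _ hmn hmn).2 fun y hy => ⟨y, le_rfl, hy⟩
    · obtain ⟨i, hi, hmax⟩ := ih hmn.le hm0
      have hin := hi.trans hmn
      by_cases him : pair i m ∈ S
      · refine ⟨m, lt_succ_iff.2 le_rfl, fun j hj => ?_⟩
        rcases (lt_succ_iff.1 hj).eq_or_lt with rfl | hj
        · exact (hmem _ _ hmn hmn).2 fun y hy => ⟨y, le_rfl, hy⟩
        · have hjn := hj.trans hmn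
          refine (hmem _ _ hjn hmn).2 fun y hy => ?_
          obtain ⟨y₁, h₁, hy₁⟩ := (hmem _ _ hin hmn).1 him y hy
          obtain ⟨y₂, h₂, hy₂⟩ := (hmem _ _ hjn hin).1 (hmax j hj) y₁ hy₁
          exact ⟨y₂, h₂.trans h₁, hy₂⟩
      · refine ⟨i, hi.trans (lt_succ_iff.2 le_rfl), fun j hj => ?_⟩
        rcases (lt_succ_iff.1 hj).eq_or_lt with rfl | hj
        · rw [hmem _ _ hin hmn] at him
          push Not at him
          obtain ⟨y, hy, hy'⟩ := him
          exact (hmem _ _ hmn hin).2 fun y₁ hy₁ =>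
            ⟨y, (not_le.1 fun hle => hy' _ hle hy₁).le, hy⟩
        · exact hmax j hj
  have hn : 0 < n := by
    obtain ⟨i, hi, -⟩ := hb 0
    exact zero_le.trans_lt hi
  obtain ⟨i, hi, hmax⟩ := hmax n le_rfl hn
  obtain ⟨y, hy⟩ := h i hi
  obtain ⟨j, hj, hj'⟩ := hb y
  obtain ⟨y', hle, hy'⟩ := (hmem _ _ hj hi).1 (hmax j hj) y hy
  exact hj' y' hle hy'

/-! ### Exponentiation -/

theorem div_unique {d q q' c c' : N} (hc : c < d) (hc' : c' < d)
    (h : q * d + c = q' * d + c') : q = q' ∧ c = c' := by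
  have key : ∀ {q q' c c' : N}, c < d → q * d + c = q' * d + c' → ¬ q < q' := by
    intro q q' c c' hc h hlt
    have h₁ : (q + 1) * d ≤ q' * d := mul_le_mul_left (succ_le_iff.2 hlt) d
    have h₂ : q * d + c < (q + 1) * d := by
      rw [add_mul, one_mul]
      exact add_lt_add_right hc _
    exact absurd (h₂.trans_le (h₁.trans le_self_add)) (by rw [h]; exact lt_irrefl _)
  have e : q = q' := le_antisymm (not_lt.1 (key hc' h.symm)) (not_lt.1 (key hc h))
  subst e
  exact ⟨rfl, add_left_cancel h⟩

theorem Beta.unique {a b i c c' : N} (h : Beta a b i c) (h' : Beta a b i c') : c = c' := by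
  obtain ⟨h₁, q, e⟩ := h
  obtain ⟨h₂, q', e'⟩ := h'
  exact (div_unique h₁ h₂ (e.symm.trans e')).2

theorem Beta.le {a b i c : N} (h : Beta a b i c) : c ≤ a := by
  obtain ⟨_, q, rfl⟩ := h
  exact le_add_self

theorem D0.beta (hf : F0 X f) (hg : F0 X g) (hh : F0 X h) (hk : F0 X k) :
    D0 X (fun v => Beta (f v) (g v) (h v) (k v)) := by
  refine (D0.and (.lt' hk ((F0.const 1).add ((hh.add (.const 1)).mul hg)))
    (.ex_le (R := fun v q => f v = q * (1 + (h v + 1) * g v) + k v) hf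
      (.eq' hf.wk ((F0.last.mul ((F0.const 1).add ((hh.wk.add (.const 1)).mul hg.wk))).add
        hk.wk)))).congr fun v => and_congr_right fun _ => ?_
  refine ⟨fun ⟨q, hq⟩ => ⟨q, ?_, hq⟩, fun ⟨q, _, hq⟩ => ⟨q, hq⟩⟩
  rw [hq, mul_add, mul_one, add_assoc]
  exact le_self_add

theorem D0.expSeq (hf : F0 X f) (hg : F0 X g) (hh : F0 X h) (hk : F0 X k) :
    D0 X (fun v => ExpSeq (f v) (g v) (h v) (k v)) := by
  refine (D0.and (.beta hf hg (.const 0) (.const 1)) (.and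
    (.all (R := fun v i => ∃ c, c ≤ f v ∧ Beta (f v) (g v) i c ∧ Beta (f v) (g v) (i + 1) (c + c))
      hh (.ex_le (R := fun v c => Beta (f (Fin.init v)) (g (Fin.init v)) (v (Fin.last n)) c ∧
          Beta (f (Fin.init v)) (g (Fin.init v)) (v (Fin.last n) + 1) (c + c)) hf.wk
        (.and (.beta hf.wk.wk hg.wk.wk (.var _) .last)
          (.beta hf.wk.wk hg.wk.wk ((F0.var _).add (.const 1)) (F0.last.add .last)))))
    (.beta hf hg hh hk))).congr fun v => ?_
  refine and_congr_right fun _ => and_congr_left fun _ => forall₂_congr fun i _ => ?_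
  exact ⟨fun ⟨c, h₁, h₂⟩ => ⟨c, h₁.le, h₁, h₂⟩, fun ⟨c, _, h⟩ => ⟨c, h⟩⟩

open Classical in
/-- The `i`-th entry of the sequence coded by `a, b`. -/
noncomputable def betaVal (a b i : N) : N := if h : ∃ c, Beta a b i c then h.choose else 0

theorem Beta.betaVal_eq {a b i c : N} (h : Beta a b i c) : betaVal a b i = c := by
  have h' : ∃ c, Beta a b i c := ⟨c, h⟩
  rw [betaVal, dif_pos h']
  exact h'.choose_spec.unique h

/-- For fixed `a, b` the entries are bounded by the constant `a`. In this way powers of two enter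
bounded relations although they have no polynomial bound. -/
theorem F0.betaVal (a b : N) (hf : F0 X f) : F0 X (fun v => betaVal a b (f v)) := by
  refine .of_le (.const a) (fun v => ?_) ((D0.or (.beta (.const a) (.const b) hf.wk .last)
    (.and (D0.not (.ex_le (R := fun v c => Beta a b (f (Fin.init v)) c) (.const a)
      (.beta (.const a) (.const b) hf.wk.wk .last))) (.eq' .last (.const 0)))).congr fun v => ?_)
  · by_cases h : ∃ c, Beta a b (f v) c
    · obtain ⟨c, h⟩ := h
      rw [h.betaVal_eq]
      exact h.le
    · simp [SecondOrderArith.betaVal, h]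
  · by_cases h : ∃ c, Beta a b (f (Fin.init v)) c
    · obtain ⟨c, h⟩ := h
      rw [h.betaVal_eq]
      exact ⟨fun e => .inl (e ▸ h),
        fun h' => h'.elim (fun h' => h'.unique h) fun h' => (h'.1 ⟨c, h.le, h⟩).elim⟩
    · have h0 : SecondOrderArith.betaVal a b (f (Fin.init v)) = 0 := by
        simp [SecondOrderArith.betaVal, h]
      rw [h0]
      exact ⟨fun e => .inr ⟨fun ⟨c, _, hc⟩ => h ⟨c, hc⟩, e⟩,
        fun h' => h'.elim (fun h' => (h ⟨_, h'⟩).elim) And.right⟩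

theorem ExpSeq.betaVal_zero {a b x y : N} (h : ExpSeq a b x y) : betaVal a b 0 = 1 :=
  h.1.betaVal_eq

theorem ExpSeq.betaVal_succ {a b x y i : N} (h : ExpSeq a b x y) (hi : i < x) :
    betaVal a b (i + 1) = betaVal a b i + betaVal a b i := by
  obtain ⟨c, h₁, h₂⟩ := h.2.1 i hi
  rw [h₁.betaVal_eq, h₂.betaVal_eq]

theorem ExpSeq.betaVal_last {a b x y : N} (h : ExpSeq a b x y) : betaVal a b x = y :=
  h.2.2.betaVal_eq

theorem ExpSeq.succ_le_betaVal (X : Set (Set N)) [Arith X] {a b x y : N} (h : ExpSeq a b x y)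
    (i : N) : i ≤ x → i + 1 ≤ betaVal a b i := by
  refine ind (X := X) (P := fun i => i ≤ x → i + 1 ≤ betaVal a b i)
    (.imp (.le (.var 0) (.const x)) (.le (F0.succ (.var 0)) (.betaVal a b (.var 0)))) ?_ ?_ i
  · intro _
    rw [h.betaVal_zero, zero_add]
  · intro i ih hi
    rw [h.betaVal_succ (succ_le_iff.1 hi)]
    have := ih (le_of_lt (succ_le_iff.1 hi))
    exact add_le_add this (le_add_self.trans this)

theorem ExpSeq.betaVal_add (X : Set (Set N)) [Arith X] {a b x y : N} (h : ExpSeq a b x y)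
    (j i : N) : j + i ≤ x → betaVal a b (j + i) = betaVal a b j * betaVal a b i := by
  refine ind (X := X) (P := fun i => j + i ≤ x → betaVal a b (j + i) = betaVal a b j * betaVal a b i)
    (.imp (.le ((F0.const j).add (.var 0)) (.const x)) (.eq'
      (.betaVal a b ((F0.const j).add (.var 0)))
      ((F0.const _).mul (.betaVal a b (.var 0))))) ?_ ?_ i
  · intro _
    rw [h.betaVal_zero, add_zero, mul_one]
  · intro i ih hi
    rw [← add_assoc, succ_le_iff] at hi
    rw [← add_assoc, h.betaVal_succ hi, ih hi.le, h.betaVal_succ (le_add_self.trans_lt hi), mul_add]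

theorem ExpSeq.betaVal_strictMono (X : Set (Set N)) [Arith X] {a b x y i : N}
    (h : ExpSeq a b x y) (hi : i < x) : betaVal a b i < betaVal a b x := by
  obtain ⟨d, rfl⟩ := exists_add_of_le hi.le
  rw [h.betaVal_add X i d le_rfl]
  have hd : 0 < d := pos_of_lt_add_right hi
  have h₁ := h.succ_le_betaVal X i hi.le
  have h₂ := h.succ_le_betaVal X d le_add_self
  have h₃ : 1 < betaVal a b d := by
    refine lt_of_lt_of_le ?_ h₂
    simpa using hd
  exact lt_mul_of_one_lt_right (lt_of_lt_of_le (lt_succ_iff.2 zero_le) h₁) h₃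

/-- `x ↦ 2 ^ x` is injective. -/
theorem ExpSeq.injective (X : Set (Set N)) [Arith X] {a b x y a' b' x' : N}
    (h : ExpSeq a b x y) (h' : ExpSeq a' b' x' y) : x = x' := by
  have key : ∀ {a b x a' b' x' : N}, ExpSeq a b x y → ExpSeq a' b' x' y → ¬ x < x' := by
    intro a b x a' b' x' h h' hlt
    have e : ∀ i, i ≤ x → betaVal a b i = betaVal a' b' i := by
      refine ind (X := X) (.imp (.le (.var 0) (.const x))
        (.eq' (.betaVal a b (.var 0)) (.betaVal a' b' (.var 0)))) ?_ ?_
      · intro _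
        rw [h.betaVal_zero, h'.betaVal_zero]
      · intro i ih hi
        rw [succ_le_iff] at hi
        rw [h.betaVal_succ hi, h'.betaVal_succ (hi.trans hlt), ih hi.le]
    have := h'.betaVal_strictMono X hlt
    rw [← e x le_rfl, h.betaVal_last, h'.betaVal_last] at this
    exact lt_irrefl _ this
  exact le_antisymm (not_lt.1 (key h' h)) (not_lt.1 (key h h'))

/-- Iteration of a step that increases values at most by a constant factor. -/
theorem exists_iterate {Q : N → N → Prop} (hQ : D0 X (fun v : Fin 2 → N => Q (v 0) (v 1)))
    (C b : N) (h0 : Q 0 1) (hs : ∀ j m, j < b → Q j m → ∃ m', m' ≤ m * C ∧ Q (j + 1) m') :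
    ∃ m, Q b m := by
  -- After `j` steps the value is at most `C ^ j ≤ 2 ^ (C * j)`. A coded table of powers of two,
  -- used as a parameter, turns this into a bound admissible in `Δ⁰₀` induction. The additional `C`
  -- is slack for the step from `C * j` to `C * j + C`.
  obtain ⟨y, p, q, hE⟩ := Arith.exp X (C * b + C)
  have key : ∀ j, j ≤ b → ∃ m, m ≤ betaVal p q (C * j) ∧ Q j m := by
    refine ind (X := X) (.imp (.le (.var 0) (.const b)) (.ex_le (R := fun v m => Q (v 0) m)
      (.betaVal p q ((F0.const C).mul (.var 0))) (.comp₂ hQ (.var _) .last))) ?_ ?_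
    · intro _
      exact ⟨1, by rw [mul_zero, hE.betaVal_zero], h0⟩
    · intro j ih hj
      rw [succ_le_iff] at hj
      obtain ⟨m, hm, hQm⟩ := ih hj.le
      obtain ⟨m', hm', hQm'⟩ := hs j m hj hQm
      refine ⟨m', hm'.trans ?_, hQm'⟩
      rw [mul_add, mul_one, hE.betaVal_add X _ _ (add_le_add_left (mul_le_mul_right hj.le C) C)]
      exact mul_le_mul' hm (le_self_add.trans (hE.succ_le_betaVal X C le_add_self))
  obtain ⟨m, _, hm⟩ := key b le_rfl
  exact ⟨m, hm⟩

/-! ### Finite sets -/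

theorem dvd_of_dvd_add {u x y : N} (h : u ∣ x + y) (h' : u ∣ y) : u ∣ x := by
  obtain ⟨s, hs⟩ := h
  obtain ⟨t, rfl⟩ := h'
  rcases le_total t s with hts | hts
  · obtain ⟨r, rfl⟩ := exists_add_of_le hts
    refine ⟨r, ?_⟩
    rw [mul_add, add_comm] at hs
    exact add_left_cancel hs
  · have h₁ : u * t = x + u * t :=
      le_antisymm le_add_self (hs.trans_le (mul_le_mul_right hts u))
    have h₂ : x = 0 := by
      have : 0 + u * t = x + u * t := by rw [zero_add]; exact h₁
      exact (add_right_cancel this).symm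
    rw [h₂]
    exact dvd_zero _

/-- `z + q * (z * m) = z * (1 + q * m)`, and the second summand is divisible by assumption. In
effect, `m` is invertible modulo `1 + q * m`. -/
theorem dvd_of_dvd_mul {q m z : N} (h : 1 + q * m ∣ z * m) : 1 + q * m ∣ z := by
  refine dvd_of_dvd_add (y := q * (z * m)) ?_ (h.mul_left q)
  exact ⟨z, by ring⟩

/-- The moduli at `w` and `j` differ by `d * m` with `d = |w - j|`, so the modulus at `w` divides `a
* d * m`. Here `m` can be cancelled; then `d` is completed to `m`, which it divides, and cancelled
too. No greatest common divisors are needed. -/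
theorem beta_coprime {b m w j a : N} (hm : ∀ i, i < b → i + 1 ∣ m) (hw : w < b) (hj : j < b)
    (hne : w ≠ j) (h : 1 + (w + 1) * m ∣ a * (1 + (j + 1) * m)) : 1 + (w + 1) * m ∣ a := by
  have key : ∀ d, 0 < d → d ≤ b → 1 + (w + 1) * m ∣ a * d * m → 1 + (w + 1) * m ∣ a := by
    intro d hd hdb h'
    obtain rfl | ⟨i, rfl⟩ := eq_zero_or_succ d
    · exact (lt_irrefl _ hd).elim
    obtain ⟨k, hk⟩ := hm i (succ_le_iff.1 hdb)
    refine dvd_of_dvd_mul ?_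
    have := (dvd_of_dvd_mul h').mul_right k
    rwa [mul_assoc, ← hk] at this
  rcases lt_or_gt_of_ne hne with hlt | hlt
  · obtain ⟨d, rfl⟩ := exists_add_of_le hlt.le
    refine key d (pos_of_lt_add_right hlt) (le_add_self.trans hj.le) ?_
    refine dvd_of_dvd_add (y := a * (1 + (w + 1) * m)) ?_ (dvd_mul_left _ _)
    convert h using 1
    ring
  · obtain ⟨d, rfl⟩ := exists_add_of_le hlt.le
    refine key d (pos_of_lt_add_right hlt) (le_add_self.trans hw.le) ?_
    refine dvd_of_dvd_add (y := a * (1 + (j + 1) * m)) ?_ h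
    exact ⟨a, by ring⟩

/-- `w` belongs to the finite set coded by `c`. -/
def El (w c : N) : Prop := w < left c ∧ 1 + (w + 1) * right (right c) ∣ left (right c)

theorem D0.el (hf : F0 X f) (hg : F0 X g) : D0 X (fun v => El (f v) (g v)) :=
  .and (.lt' hf hg.left) (.dvd ((F0.const 1).add ((hf.add (.const 1)).mul hg.right.right))
    hg.right.left)

theorem El.lt {w c : N} (h : El w c) : w < c := h.1.trans_le (left_le c)

/-- Bounded parts of sets with bounded definition are coded. -/
theorem exists_code {R : N → Prop} (hR : D0 X (fun v : Fin 1 → N => R (v 0))) (b : N) :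
    ∃ c, ∀ w, El w c ↔ w < b ∧ R w := by
  -- A positive common multiple of `1, …, b` makes the moduli `1 + (w + 1) * m` for `w < b` coprime
  -- in the sense of `beta_coprime`.
  obtain ⟨m, hm0, hm⟩ : ∃ m : N, 0 < m ∧ ∀ i, i < b → i + 1 ∣ m := by
    refine exists_iterate (X := X) (Q := fun j m => 0 < m ∧ ∀ i, i < j → i + 1 ∣ m)
      (.and (.lt' (.const 0) (.var 1)) (.all (.var 0) (.dvd F0.last.succ (.var _)))) b b
      ⟨zero_lt_one, fun i hi => (not_lt_zero hi).elim⟩ ?_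
    rintro j m hj ⟨hm0, hm⟩
    refine ⟨m * (j + 1), mul_le_mul_right (succ_le_iff.2 hj) m,
      mul_pos hm0 (lt_succ_iff.2 zero_le), fun i hi => ?_⟩
    rcases (lt_succ_iff.1 hi).eq_or_lt with rfl | hi
    exacts [dvd_mul_left _ _, (hm i hi).mul_right _]
  -- `a` is the product of the moduli that belong to the elements of `R` below `b`, built up one
  -- factor at a time.
  obtain ⟨a, ha⟩ : ∃ a : N, ∀ w, w < b → (1 + (w + 1) * m ∣ a ↔ w < b ∧ R w) := by
    refine exists_iterate (X := X)
      (Q := fun j a => ∀ w, w < b → (1 + (w + 1) * m ∣ a ↔ w < j ∧ R w))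
      (.all (R := fun v w => 1 + (w + 1) * m ∣ v 1 ↔ w < v 0 ∧ R w) (.const b)
        (.iff (.dvd ((F0.const 1).add (F0.last.succ.mul (.const m))) (.var _))
          (.and (.lt' .last (.var _)) (.comp₁ hR .last)))) (1 + (b + 1) * m) b ?_ ?_
    · intro w _
      refine iff_of_false ?_ (fun h => not_lt_zero h.1)
      rintro ⟨t, ht⟩
      have h₁ : 0 < (w + 1) * m := mul_pos (lt_succ_iff.2 zero_le) hm0
      rcases eq_zero_or_succ t with rfl | ⟨s, rfl⟩
      · simp at ht
      · have h₂ : 1 + (w + 1) * m ≤ 1 := by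
          conv_rhs => rw [ht, mul_add, mul_one]
          exact le_add_self
        exact absurd (lt_add_of_pos_right 1 h₁) h₂.not_gt
    · intro j a hj ha
      by_cases hRj : R j
      · refine ⟨a * (1 + (j + 1) * m), mul_le_mul_right (add_le_add_right
          (mul_le_mul_left (add_le_add_left hj.le 1) m) 1) a, fun w hw => ?_⟩
        by_cases hwj : w = j
        · subst hwj
          exact iff_of_true (dvd_mul_left _ _) ⟨lt_succ_iff.2 le_rfl, hRj⟩
        · rw [lt_succ_iff, le_iff_lt_or_eq, or_iff_left hwj, ← ha w hw]
          exact ⟨beta_coprime hm hw hj hwj, fun h => h.mul_right _⟩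
      · refine ⟨a, le_mul_of_one_le_right zero_le le_self_add, fun w hw => ?_⟩
        rw [ha w hw, lt_succ_iff, le_iff_lt_or_eq]
        refine ⟨fun h => ⟨.inl h.1, h.2⟩, ?_⟩
        rintro ⟨h | rfl, h'⟩
        exacts [⟨h, h'⟩, (hRj h').elim]
  refine ⟨pair b (pair a m), fun w => ?_⟩
  simp only [El, left_pair, right_pair]
  exact ⟨fun h => (ha w h.1).1 h.2, fun h => ⟨h.1, (ha w h.1).2 h⟩⟩

end Arith

/-! ## Programs -/

section Programs

variable {N : Type u} [CommSemiring N] [LinearOrder N] [IsDiscretelyOrdered N]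

open Classical in
/-- The basic functions, with oracle `J`. -/
noncomputable def baseFun (J : Set N) (c x : N) : N :=
  if left c = 0 then right c
  else if left c = 1 then left x
  else if left c = 2 then right x
  else if left c = 3 then left x + right x
  else if left c = 4 then left x * right x
  else if left c = 5 then if left x < right x then 1 else 0
  else if left c = 6 then if x ∈ J then 1 else 0
  else x

/-- The statement that the program `e` has output `y` on input `x`. -/
def fact (e x y : N) : N := pair e (pair x y)

/-- The fact `e, x, y` follows in one step from the facts in the finite set coded by `S`. -/
def Follows (J : Set N) (S e x y : N) : Prop :=
  -- The cases are basic functions, composition, pairing and search for the first output `1` after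
  -- outputs `0`. Each case refers only to programs smaller than `e`, so facts cannot support one
  -- another in a circle.
  (left e = 0 ∧ y = baseFun J (right e) x) ∨
  -- The bound on `z` keeps the relation `Δ⁰₀`; it is automatic, as elements of a coded set are
  -- below its code.
  (left e = 1 ∧ ∃ z, z < S ∧ El (fact (right (right e)) x z) S ∧
    El (fact (left (right e)) z y) S) ∨
  -- Pairing is not surjective, so it has to be required that `y` is a pair.
  (left e = 2 ∧ y = pair (left y) (right y) ∧ El (fact (left (right e)) x (left y)) S ∧
    El (fact (right (right e)) x (right y)) S) ∨
  (left e = 3 ∧ El (fact (right e) (pair x y) 1) S ∧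
    ∀ z, z < y → El (fact (right e) (pair x z) 0) S)

/-- All facts in the finite set coded by `S` follow from others. -/
def Justified (J : Set N) (S : N) : Prop :=
  ∀ w, w < S → El w S → Follows J S (left w) (left (right w)) (right (right w))

/-- The program `e` has output `y` on input `x`. -/
def Derives (J : Set N) (e x y : N) : Prop := ∃ S, Justified J S ∧ El (fact e x y) S

variable {X : Set (Set N)} [Arith X] {n : ℕ} {J : Set N} {f g h k : (Fin n → N) → N}

theorem F0.fact (hf : F0 X f) (hg : F0 X g) (hh : F0 X h) :
    F0 X (fun v => fact (f v) (g v) (h v)) := .pair hf (.pair hg hh)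

open Classical in
theorem F0.baseFun (hJ : J ∈ X) (hf : F0 X f) (hg : F0 X g) :
    F0 X (fun v => baseFun J (f v) (g v)) :=
  .ite (.eq' hf.left (.const 0)) hf.right <| .ite (.eq' hf.left (.const 1)) hg.left <|
  .ite (.eq' hf.left (.const 2)) hg.right <|
  .ite (.eq' hf.left (.const 3)) (hg.left.add hg.right) <|
  .ite (.eq' hf.left (.const 4)) (hg.left.mul hg.right) <|
  .ite (.eq' hf.left (.const 5)) (.ite (.lt' hg.left hg.right) (.const 1) (.const 0)) <|
  .ite (.eq' hf.left (.const 6)) (.ite (.mem' hJ hg) (.const 1) (.const 0)) hg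

theorem D0.follows (hJ : J ∈ X) (hf : F0 X f) (hg : F0 X g) (hh : F0 X h) (hk : F0 X k) :
    D0 X (fun v => Follows J (f v) (g v) (h v) (k v)) :=
  .or (.and (.eq' hg.left (.const 0)) (.eq' hk (.baseFun hJ hg.right hh))) <|
  .or (.and (.eq' hg.left (.const 1)) (.ex (R := fun v z => El (fact (right (right (g v))) (h v) z)
      (f v) ∧ El (fact (left (right (g v))) z (k v)) (f v)) hf
    (.and (.el (.fact hg.wk.right.right hh.wk .last) hf.wk)
      (.el (.fact hg.wk.right.left .last hk.wk) hf.wk)))) <|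
  .or (.and (.eq' hg.left (.const 2)) (.and (.eq' hk (.pair hk.left hk.right))
    (.and (.el (.fact hg.right.left hh hk.left) hf)
      (.el (.fact hg.right.right hh hk.right) hf))))
  (.and (.eq' hg.left (.const 3)) (.and (.el (.fact hg.right (.pair hh hk) (.const 1)) hf)
    (.all (R := fun v z => El (fact (right (g v)) (pair (h v) z) 0) (f v)) hk
      (.el (.fact hg.wk.right (.pair hh.wk .last) (.const 0)) hf.wk))))

theorem D0.justified (hJ : J ∈ X) (hf : F0 X f) : D0 X (fun v => Justified J (f v)) :=
  .all (R := fun v w => El w (f v) →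
    Follows J (f v) (left w) (left (right w)) (right (right w))) hf
    (.imp (.el .last hf.wk) (.follows hJ hf.wk F0.last.left F0.last.right.left F0.last.right.right))

theorem Justified.follows {S e x y : N} (h : Justified J S) (h' : El (fact e x y) S) :
    Follows J S e x y := by
  simpa [fact] using h _ h'.lt h'

theorem Follows.mono {S S' e x y : N} (hS : ∀ w, El w S → El w S') (h : Follows J S e x y) :
    Follows J S' e x y := by
  rcases h with h | ⟨h, z, _, h₁, h₂⟩ | ⟨h, h₀, h₁, h₂⟩ | ⟨h, h₁, h₂⟩
  · exact .inl h
  · refine .inr (.inl ⟨h, z, ?_, hS _ h₁, hS _ h₂⟩)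
    exact ((le_pair_right x z).trans (le_pair_right _ _)).trans_lt (hS _ h₁).lt
  · exact .inr (.inr (.inl ⟨h, h₀, hS _ h₁, hS _ h₂⟩))
  · exact .inr (.inr (.inr ⟨h, hS _ h₁, fun z hz => hS _ (h₂ z hz)⟩))

/-! ### Combining derivations -/

theorem Justified.insert (_hJ : J ∈ X) {S e x y : N} (h : Justified J S)
    (h' : Follows J S e x y) : Derives J e x y := by
  obtain ⟨S', hS'⟩ := exists_code (X := X) (R := fun w => El w S ∨ w = fact e x y)
    (.or (.el (.var 0) (.const S)) (.eq' (.var 0) (.const _))) (S + fact e x y + 1)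
  have hsub : ∀ w, El w S → El w S' := fun w hw =>
    (hS' w).2 ⟨lt_succ_iff.2 (hw.lt.le.trans le_self_add), .inl hw⟩
  refine ⟨S', fun w _ hw => ?_, (hS' _).2 ⟨lt_succ_iff.2 le_add_self, .inr rfl⟩⟩
  rcases ((hS' w).1 hw).2 with hw | rfl
  · exact (h w hw.lt hw).mono hsub
  · simpa [fact] using h'.mono hsub

/-- The union of all justified sets with codes up to `B` is justified, since a step remains valid in
a larger set. Its elements are below `B`, so it is coded. Thus derivations are merged without
recursion. -/
theorem exists_justified_of_bound (hJ : J ∈ X) (B : N) :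
    ∃ S', Justified J S' ∧ ∀ S, S ≤ B → Justified J S → ∀ w, El w S → El w S' := by
  obtain ⟨S', hS'⟩ := exists_code (X := X) (R := fun w => ∃ S, S ≤ B ∧ Justified J S ∧ El w S)
    (.ex_le (R := fun v S => Justified J S ∧ El (v 0) S) (.const B)
      (.and (.justified hJ .last) (.el (.var _) .last))) B
  have hsub : ∀ S, S ≤ B → Justified J S → ∀ w, El w S → El w S' := fun S hS h w hw =>
    (hS' w).2 ⟨hw.lt.trans_le hS, S, hS, h, hw⟩
  refine ⟨S', fun w _ hw => ?_, hsub⟩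
  obtain ⟨_, S, hS, hj, hw⟩ := (hS' w).1 hw
  exact (hj w hw.lt hw).mono (hsub S hS hj)

theorem exists_justified_pair (hJ : J ∈ X) {e x y e' x' y' : N} (h : Derives J e x y)
    (h' : Derives J e' x' y') :
    ∃ S, Justified J S ∧ El (fact e x y) S ∧ El (fact e' x' y') S := by
  obtain ⟨S, hS, h⟩ := h
  obtain ⟨T, hT, h'⟩ := h'
  obtain ⟨U, hU, hsub⟩ := exists_justified_of_bound hJ (S + T)
  exact ⟨U, hU, hsub S le_self_add hS _ h, hsub T le_add_self hT _ h'⟩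

theorem derives_base_iff (hJ : J ∈ X) {c x y : N} :
    Derives J (pair 0 c) x y ↔ y = baseFun J c x := by
  constructor
  · rintro ⟨S, hS, h⟩
    simpa [Follows] using hS.follows h
  · rintro rfl
    obtain ⟨S, hS⟩ := exists_code (X := X) (R := fun _ => False) .falsum 0
    refine Justified.insert (S := S) hJ (fun w _ hw => ((hS w).1 hw).2.elim) (.inl ?_)
    simp

theorem derives_comp_iff (hJ : J ∈ X) {i j x y : N} :
    Derives J (pair 1 (pair i j)) x y ↔ ∃ z, Derives J j x z ∧ Derives J i z y := by
  constructor
  · rintro ⟨S, hS, h⟩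
    obtain ⟨z, _, h₁, h₂⟩ : ∃ z, z < S ∧ El (fact j x z) S ∧ El (fact i z y) S := by
      simpa [Follows] using hS.follows h
    exact ⟨z, ⟨S, hS, h₁⟩, S, hS, h₂⟩
  · rintro ⟨z, h₁, h₂⟩
    obtain ⟨S, hS, h₁, h₂⟩ := exists_justified_pair hJ h₁ h₂
    refine hS.insert hJ (.inr (.inl ?_))
    simp only [left_pair, right_pair, true_and]
    exact ⟨z, ((le_pair_right x z).trans (le_pair_right _ _)).trans_lt h₁.lt, h₁, h₂⟩

theorem derives_pair_iff (hJ : J ∈ X) {i j x y : N} :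
    Derives J (pair 2 (pair i j)) x y ↔
      ∃ u v, y = pair u v ∧ Derives J i x u ∧ Derives J j x v := by
  constructor
  · rintro ⟨S, hS, h⟩
    obtain ⟨h₀, h₁, h₂⟩ : y = pair (left y) (right y) ∧ El (fact i x (left y)) S ∧
        El (fact j x (right y)) S := by
      simpa [Follows] using hS.follows h
    exact ⟨_, _, h₀, ⟨S, hS, h₁⟩, S, hS, h₂⟩
  · rintro ⟨u, v, rfl, h₁, h₂⟩
    obtain ⟨S, hS, h₁, h₂⟩ := exists_justified_pair hJ h₁ h₂
    refine hS.insert hJ (.inr (.inr (.inl ?_)))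
    simpa using ⟨h₁, h₂⟩

/-- From right to left, the derivations for all `z < y` must be put into one finite set. Collection
bounds their codes, and then they can be merged at once. -/
theorem derives_search_iff (hJ : J ∈ X) {i x y : N} :
    Derives J (pair 3 i) x y ↔
      Derives J i (pair x y) 1 ∧ ∀ z, z < y → Derives J i (pair x z) 0 := by
  constructor
  · rintro ⟨S, hS, h⟩
    obtain ⟨h₁, h₂⟩ : El (fact i (pair x y) 1) S ∧ ∀ z, z < y → El (fact i (pair x z) 0) S := by
      simpa [Follows] using hS.follows h
    exact ⟨⟨S, hS, h₁⟩, fun z hz => ⟨S, hS, h₂ z hz⟩⟩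
  · rintro ⟨⟨S, hS, h₁⟩, h₂⟩
    obtain ⟨b, hb⟩ := collection (X := X)
      (R := fun z S => Justified J S ∧ El (fact i (pair x z) 0) S)
      (.and (.justified hJ (.var 1))
        (.el (.fact (.const i) (.pair (.const x) (.var 0)) (.const 0)) (.var 1))) y h₂
    obtain ⟨U, hU, hsub⟩ := exists_justified_of_bound hJ (S + b)
    refine hU.insert hJ (.inr (.inr (.inr ?_)))
    simp only [left_pair, right_pair, true_and]
    refine ⟨hsub S le_self_add hS _ h₁, fun z hz => ?_⟩
    obtain ⟨T, hT, hT', h⟩ := hb z hz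
    exact hsub T (hT.trans le_add_self) hT' _ h

/-- `F` is computed by the program `e` with oracle `J`. -/
def Computes (J : Set N) (e : N) (F : N → N) : Prop := ∀ x y, Derives J e x y ↔ y = F x

/-- `F` is computable with oracle `J` and number parameters. -/
def IsComp (J : Set N) (F : N → N) : Prop := ∃ e, Computes J e F

open Classical in
/-- The characteristic function of a property. -/
noncomputable def chi (P : N → Prop) (x : N) : N := if P x then 1 else 0

theorem chi_congr {P Q : N → Prop} {x y : N} (h : P x ↔ Q y) : chi P x = chi Q y := by
  unfold chi
  by_cases hP : P x
  · rw [if_pos hP, if_pos (h.1 hP)]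
  · rw [if_neg hP, if_neg fun hQ => hP (h.2 hQ)]

/-! ### Closure properties of the computable functions -/

section

variable (hJ : J ∈ X) {F G H : N → N} {P Q : N → Prop}

include hJ

theorem IsComp.base (c : N) : IsComp J (baseFun J c) := ⟨_, fun _ _ => derives_base_iff hJ⟩

theorem IsComp.const (c : N) : IsComp J (fun _ => c) := by
  convert IsComp.base hJ (SecondOrderArith.pair 0 c) using 1
  funext x
  simp [baseFun]

theorem IsComp.left : IsComp J (left : N → N) := by
  convert IsComp.base hJ (pair 1 0) using 1
  funext x
  simp [baseFun]

theorem IsComp.right : IsComp J (right : N → N) := by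
  convert IsComp.base hJ (pair 2 0) using 1
  funext x
  simp [baseFun]

theorem IsComp.id : IsComp J (fun x => x) := by
  convert IsComp.base hJ (pair 7 0) using 1
  funext x
  simp [baseFun]

theorem IsComp.oracle : IsComp J (chi (· ∈ J)) := by
  convert IsComp.base hJ (pair 6 0) using 1
  funext x
  simp [baseFun, chi]

theorem IsComp.comp (hF : IsComp J F) (hG : IsComp J G) : IsComp J (fun x => F (G x)) := by
  obtain ⟨i, hi⟩ := hF
  obtain ⟨j, hj⟩ := hG
  refine ⟨pair 1 (pair i j), fun x y => ?_⟩
  simp [derives_comp_iff hJ, hi _ _, hj _ _]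

theorem IsComp.pair (hF : IsComp J F) (hG : IsComp J G) :
    IsComp J (fun x => pair (F x) (G x)) := by
  obtain ⟨i, hi⟩ := hF
  obtain ⟨j, hj⟩ := hG
  refine ⟨SecondOrderArith.pair 2 (SecondOrderArith.pair i j), fun x y => ?_⟩
  simp [derives_pair_iff hJ, hi _ _, hj _ _]

theorem IsComp.add (hF : IsComp J F) (hG : IsComp J G) : IsComp J (fun x => F x + G x) := by
  convert IsComp.comp hJ (IsComp.base hJ (SecondOrderArith.pair 3 0)) (IsComp.pair hJ hF hG) using 1
  funext x
  simp [baseFun]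

theorem IsComp.mul (hF : IsComp J F) (hG : IsComp J G) : IsComp J (fun x => F x * G x) := by
  convert IsComp.comp hJ (IsComp.base hJ (SecondOrderArith.pair 4 0)) (IsComp.pair hJ hF hG) using 1
  funext x
  simp [baseFun]

theorem IsComp.lt (hF : IsComp J F) (hG : IsComp J G) :
    IsComp J (chi fun x => F x < G x) := by
  convert IsComp.comp hJ (IsComp.base hJ (SecondOrderArith.pair 5 0)) (IsComp.pair hJ hF hG) using 1
  funext x
  simp [baseFun, chi]

theorem IsComp.not (hP : IsComp J (chi P)) : IsComp J (chi fun x => ¬ P x) := by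
  convert IsComp.lt hJ hP (IsComp.const hJ 1) using 2
  funext x
  by_cases h : P x <;> simp [chi, h]

theorem IsComp.imp (hP : IsComp J (chi P)) (hQ : IsComp J (chi Q)) :
    IsComp J (chi fun x => P x → Q x) := by
  convert IsComp.not hJ (IsComp.lt hJ hQ hP) using 2
  funext x
  by_cases h : P x <;> by_cases h' : Q x <;> simp [chi, h, h']

theorem IsComp.search {R : N → N → Prop} (hR : IsComp J (chi fun w => R (SecondOrderArith.left w)
    (SecondOrderArith.right w))) (hF : ∀ x, R x (F x) ∧ ∀ z, z < F x → ¬ R x z) : IsComp J F := by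
  obtain ⟨i, hi⟩ := hR
  refine ⟨SecondOrderArith.pair 3 i, fun x y => ?_⟩
  simp only [derives_search_iff hJ, hi _ _, chi, left_pair, right_pair]
  constructor
  · rintro ⟨h₁, h₂⟩
    have h₁ : R x y := by
      by_contra h
      simp [h] at h₁
    have h₂ : ∀ z, z < y → ¬ R x z := fun z hz h => by
      have := h₂ z hz
      simp [h] at this
    exact le_antisymm (not_lt.1 fun hlt => h₂ _ hlt (hF x).1) (not_lt.1 fun hlt => (hF x).2 _ hlt h₁)
  · rintro rfl
    exact ⟨by simp [(hF x).1], fun z hz => by simp [(hF x).2 z hz]⟩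

end

/-! ### The sets computable from `J` -/

/-- The sets in `X` that are computable with oracle `J`. -/
def compSets (X : Set (Set N)) (J : Set N) : Set (Set N) := {B ∈ X | IsComp J (chi (· ∈ B))}

/-- The tuple coded by a number. -/
noncomputable def tuple : (n : ℕ) → N → Fin n → N
  | 0, _ => Fin.elim0
  | n + 1, x => Fin.snoc (α := fun _ => N) (tuple n (left x)) (right x)

theorem IsComp.tuple (hJ : J ∈ X) (i : Fin n) : IsComp J (fun x => tuple n x i) := by
  induction n with
  | zero => exact i.elim0
  | succ n ih =>
    refine Fin.lastCases ?_ (fun i => ?_) i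
    · simpa [SecondOrderArith.tuple] using IsComp.right hJ
    · simpa [SecondOrderArith.tuple] using IsComp.comp hJ (ih i) (IsComp.left hJ)

theorem PolyFun.isComp (hJ : J ∈ X) (hf : PolyFun f) : IsComp J (fun x => f (tuple n x)) := by
  induction hf with
  | var i => exact .tuple hJ i
  | const c => exact .const hJ c
  | add _ _ ih₁ ih₂ => exact .add hJ ih₁ ih₂
  | mul _ _ ih₁ ih₂ => exact .mul hJ ih₁ ih₂

theorem D0.snoc_const {R : (Fin (n + 1) → N) → Prop} (hR : D0 X R) (c : Fin n → N) :
    D0 X (fun v : Fin 1 → N => R (Fin.snoc (α := fun _ => N) c (v 0))) := by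
  have := hR.subst (m := 1) (σ := Fin.snoc (α := fun _ => (Fin 1 → N) → N)
    (fun i _ => c i) (fun v => v 0)) fun i => by
      refine Fin.lastCases ?_ (fun i => ?_) i
      · simpa using .var _
      · simpa using .const _
  refine this.congr fun v => ?_
  congr! 1
  funext i
  refine Fin.lastCases ?_ (fun i => ?_) i <;> simp

theorem compSets_subset : compSets X J ⊆ X := fun _ h => h.1

theorem D0.isComp (hJ : J ∈ X) {R : (Fin n → N) → Prop} (hR : D0 (compSets X J) R) :
    IsComp J (chi fun x => R (tuple n x)) := by
  induction hR with
  | eq hs ht =>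
    have h₁ := IsComp.not hJ (.lt hJ (hs.isComp hJ) (ht.isComp hJ))
    have h₂ := IsComp.lt hJ (ht.isComp hJ) (hs.isComp hJ)
    convert IsComp.not hJ (.imp hJ h₁ h₂) using 2
    funext x
    refine propext ⟨fun h => ?_, fun h => ?_⟩
    · simp [h]
    · push Not at h
      exact le_antisymm h.2 h.1
  | lt hs ht => exact .lt hJ (hs.isComp hJ) (ht.isComp hJ)
  | mem hA hs =>
    have := IsComp.comp hJ hA.2 (hs.isComp hJ)
    exact this
  | falsum =>
    convert IsComp.const hJ 0 using 1
    funext x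
    simp [chi]
  | imp _ _ ih₁ ih₂ => exact .imp hJ ih₁ ih₂
  | @ball n t R ht hR ih =>
    -- A bounded quantifier is decided by a search for the least counterexample below the bound. The
    -- bound itself satisfies the searched condition vacuously, so the search always ends, and it
    -- ends below the bound if and only if there is a counterexample.
    have hS := IsComp.imp hJ (.lt hJ (.right hJ) (.comp hJ (ht.isComp hJ) (.left hJ)))
      (.not hJ ih)
    have hleast : ∀ x, ∃ z, (z < t (tuple n x) → ¬ R (Fin.snoc (α := fun _ => N) (tuple n x) z)) ∧
        ∀ y, y < z → ¬ (y < t (tuple n x) → ¬ R (Fin.snoc (α := fun _ => N) (tuple n x) y)) :=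
      fun x => exists_least (X := X)
        (P := fun z => z < t (tuple n x) → ¬ R (Fin.snoc (α := fun _ => N) (tuple n x) z))
        (.imp (.lt (.var 0) (.const _)) ((hR.mono compSets_subset).snoc_const _).not)
        (a := t (tuple n x)) (fun h => (lt_irrefl _ h).elim)
    choose F hF using hleast
    have hFc := IsComp.search hJ
      (R := fun x z => z < t (tuple n x) → ¬ R (Fin.snoc (α := fun _ => N) (tuple n x) z)) hS hF
    convert IsComp.not hJ (.lt hJ hFc (ht.isComp hJ)) using 2
    funext x
    refine propext ⟨fun h h' => (hF x).1 h' (h _ h'), fun h a ha => ?_⟩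
    have := (hF x).2 a (ha.trans_le (not_lt.1 h))
    push Not at this
    exact this.2

/-- For comprehension, the set is in `X` already and only has to be computed. Given `x`, search for
the least `b` with `Q x b → P x b`. One exists: otherwise all `Q x b` would hold and all `P x b`
fail, against their equivalence. For the `b` found, `P x b` decides membership. -/
theorem arith_compSets (hJ : J ∈ X) : Arith (compSets X J) where
  ind _ hP := ind (hP.mono compSets_subset)
  exp := Arith.exp X
  comprehension P Q hP hQ h := by
    refine ⟨Arith.comprehension P Q (hP.mono compSets_subset) (hQ.mono compSets_subset) h, ?_⟩
    have hleast : ∀ x, ∃ z, (Q x z → P x z) ∧ ∀ y, y < z → ¬ (Q x y → P x y) := fun x => by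
      obtain ⟨a, ha⟩ : ∃ a, Q x a → P x a := by
        by_contra! h'
        obtain ⟨b, hb⟩ := (h x).2 fun b => (h' b).1
        exact (h' b).2 hb
      exact exists_least (X := X) (P := fun z => Q x z → P x z)
        (.imp ((hQ.mono compSets_subset).comp₂ (.const x) (.var 0))
          ((hP.mono compSets_subset).comp₂ (.const x) (.var 0))) ha
    choose F hF using hleast
    -- A code of a tuple of length two carries an arbitrary code of the empty tuple, here `0`, in
    -- its innermost place.
    have hw : IsComp J (fun w : N => pair (pair 0 (left w)) (right w)) :=
      .pair hJ (.pair hJ (.const hJ 0) (.left hJ)) (.right hJ)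
    have key : ∀ {P : N → N → Prop}, D0 (compSets X J) (fun v : Fin 2 → N => P (v 0) (v 1)) →
        IsComp J (chi fun w => P (left w) (right w)) := fun {P} hP => by
      have h₁ := IsComp.comp hJ (hP.isComp hJ) hw
      have h₂ : ∀ x y : N, tuple 2 (pair (pair 0 x) y) 0 = x ∧ tuple 2 (pair (pair 0 x) y) 1 = y :=
        fun x y => by
          have e₁ : tuple 2 (pair (pair 0 x) y) 0 = right (left (pair (pair 0 x) y)) := rfl
          have e₂ : tuple 2 (pair (pair 0 x) y) 1 = right (pair (pair 0 x) y) := rfl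
          simp [e₁, e₂]
      convert h₁ using 1
      funext w
      exact chi_congr (by rw [(h₂ _ _).1, (h₂ _ _).2])
    have hFc := IsComp.search hJ (R := fun x z => Q x z → P x z) (.imp hJ (key hQ) (key hP)) hF
    have := IsComp.comp hJ (key hP) (.pair hJ (.id hJ) hFc)
    convert this using 1
    funext x
    refine chi_congr ?_
    rw [left_pair, right_pair]
    refine ⟨fun hx => (hF x).1 ((h x).1 hx _), fun hx => ⟨_, hx⟩⟩

theorem mem_compSets_self (hJ : J ∈ X) : J ∈ compSets X J := ⟨hJ, .oracle hJ⟩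

end Programs

/-! ## A binary tree without computable branches -/

section Tree

variable {N : Type u} [CommSemiring N] [LinearOrder N]

/-- Powers of two. -/
def IsPow (p : N) : Prop := 0 < p ∧ ∀ d, d ∣ p → 1 < d → 2 ∣ d

/-- The string coded by `s` is an initial segment of the one coded by `t`. -/
def IsInit (s t : N) : Prop := 0 < s ∧ ∃ p r, IsPow p ∧ r < p ∧ t = s * p + r

/-- Binary trees. -/
def IsBinTree (T : Set N) : Prop :=
  (∀ t, t ∈ T → 0 < t) ∧ ∀ t s, t ∈ T → IsInit s t → s ∈ T

/-- Unbounded sets. -/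
def IsUnbounded (T : Set N) : Prop := ∀ x, ∃ t, t ∈ T ∧ x < t

/-- Infinite branches of `T`. -/
def IsBranch (B T : Set N) : Prop :=
  IsBinTree B ∧ IsUnbounded B ∧ (∀ t, t ∈ B → t ∈ T) ∧
    ∀ s t, s ∈ B ∧ t ∈ B → IsInit s t ∨ IsInit t s

variable [IsDiscretelyOrdered N] {X : Set (Set N)} [Arith X] {n : ℕ} {f g h k : (Fin n → N) → N}

/-! ### Powers of two and levels of strings -/

theorem le_of_dvd {d x : N} (hx : 0 < x) (h : d ∣ x) : d ≤ x := by
  obtain ⟨q, rfl⟩ := h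
  exact le_mul_of_one_le_right zero_le
    (by simpa using succ_le_iff.2 (pos_of_mul_pos_right hx zero_le))

theorem two_mul_add_unique {a b i j : N} (hi : i < 2) (hj : j < 2) (h : 2 * a + i = 2 * b + j) :
    a = b ∧ i = j :=
  div_unique hi hj (by rwa [mul_comm a, mul_comm b])

theorem lt_two_iff {i : N} : i < 2 ↔ i = 0 ∨ i = 1 := by
  rw [← one_add_one_eq_two, lt_succ_iff]
  constructor
  · intro h
    rcases eq_zero_or_succ i with rfl | ⟨j, rfl⟩
    · exact .inl rfl
    · refine .inr (le_antisymm h le_add_self)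
  · rintro (rfl | rfl)
    exacts [zero_le, le_rfl]

theorem exists_two_mul_add (X : Set (Set N)) [Arith X] (x : N) : ∃ k i, i < 2 ∧ x = 2 * k + i := by
  have : ∃ k, k ≤ x ∧ (x = 2 * k ∨ x = 2 * k + 1) := by
    refine ind (X := X) (P := fun x => ∃ k, k ≤ x ∧ (x = 2 * k ∨ x = 2 * k + 1))
      (.ex_le (R := fun v k => v 0 = 2 * k ∨ v 0 = 2 * k + 1) (.var 0)
        (.or (.eq' (.var _) ((F0.const 2).mul .last))
          (.eq' (.var _) ((F0.const 2).mul .last).succ))) ⟨0, le_rfl, by simp⟩ ?_ x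
    rintro x ⟨k, hk, rfl | rfl⟩
    · exact ⟨k, hk.trans le_self_add, .inr rfl⟩
    · exact ⟨k + 1, add_le_add_left hk 1, .inl (by ring)⟩
  obtain ⟨k, _, h | h⟩ := this
  · exact ⟨k, 0, by simp, by rw [add_zero, h]⟩
  · exact ⟨k, 1, one_lt_two, h⟩

/-- By parity the cofactor of the odd divisor is even, and half of it is a cofactor for `x`. -/
theorem odd_dvd_of_dvd_two_mul (X : Set (Set N)) [Arith X] {k x : N} (h : 2 * k + 1 ∣ 2 * x) : 2 * k + 1 ∣ x := by
  obtain ⟨q, hq⟩ := h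
  obtain ⟨r, i, hi, rfl⟩ := exists_two_mul_add X q
  have : 2 * x + 0 = 2 * (k * (2 * r + i) + r) + i := by
    rw [add_zero, hq]
    ring
  obtain ⟨h₁, rfl⟩ := two_mul_add_unique (by simp) hi this
  exact ⟨r, by rw [h₁]; ring⟩

theorem isPow_one : IsPow (1 : N) :=
  ⟨zero_lt_one, fun _ hd hd' => absurd (le_of_dvd zero_lt_one hd) hd'.not_ge⟩

theorem IsPow.of_dvd {p q : N} (hp : IsPow p) (h : q ∣ p) : IsPow q := by
  refine ⟨?_, fun d hd => hp.2 d (hd.trans h)⟩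
  obtain ⟨r, rfl⟩ := h
  exact pos_of_mul_pos_left hp.1 zero_le

theorem IsPow.half {p : N} (hp : IsPow p) (h : 1 < p) : ∃ q, p = 2 * q ∧ IsPow q := by
  obtain ⟨q, rfl⟩ := hp.2 p dvd_rfl h
  exact ⟨q, rfl, hp.of_dvd (dvd_mul_left _ _)⟩

theorem IsPow.double (X : Set (Set N)) [Arith X] {p : N} (hp : IsPow p) : IsPow (2 * p) := by
  refine ⟨mul_pos two_pos hp.1, fun d hd hd' => ?_⟩
  obtain ⟨k, i, hi, rfl⟩ := exists_two_mul_add X d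
  obtain rfl | rfl := lt_two_iff.1 hi
  · simp
  · exact hp.2 _ (odd_dvd_of_dvd_two_mul X hd) hd'

theorem D0.isPow (hf : F0 X f) : D0 X (fun v => IsPow (f v)) := by
  refine (D0.and (.lt' (.const 0) hf) (.all_le (R := fun v d => d ∣ f v → 1 < d → 2 ∣ d) hf
    (.imp (.dvd .last hf.wk) (.imp (.lt' (.const 1) .last) (.dvd (.const 2) .last))))).congr
    fun v => and_congr_right fun h0 => ?_
  exact ⟨fun h d _ => h d, fun h d hd => h d (le_of_dvd h0 hd) hd⟩

theorem IsInit.le {s t : N} (h : IsInit s t) : s ≤ t := by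
  obtain ⟨_, p, r, hp, _, rfl⟩ := h
  exact (le_mul_of_one_le_right zero_le (by simpa using succ_le_iff.2 hp.1)).trans le_self_add

theorem D0.isInit (hf : F0 X f) (hg : F0 X g) : D0 X (fun v => IsInit (f v) (g v)) := by
  refine (D0.and (.lt' (.const 0) hf) (.ex_le
    (R := fun v p => ∃ r, r ≤ g v ∧ IsPow p ∧ r < p ∧ g v = f v * p + r) hg
    (.ex_le (R := fun v r => IsPow (v (Fin.last n)) ∧ r < v (Fin.last n) ∧
      g (Fin.init v) = f (Fin.init v) * v (Fin.last n) + r) hg.wk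
      (.and (.isPow (.var _)) (.and (.lt' .last (.var _))
        (.eq' hg.wk.wk ((hf.wk.wk.mul (.var _)).add .last))))))).congr
    fun v => and_congr_right fun h0 => ?_
  constructor
  · rintro ⟨p, r, hp, hr, h⟩
    refine ⟨p, ?_, r, ?_, hp, hr, h⟩
    · rw [h]
      exact (le_mul_of_one_le_left zero_le (by simpa using succ_le_iff.2 h0)).trans le_self_add
    · rw [h]
      exact le_add_self
  · rintro ⟨p, _, r, _, h⟩
    exact ⟨p, r, h⟩

theorem IsPow.one_or_double {p : N} (hp : IsPow p) : p = 1 ∨ ∃ q, p = 2 * q ∧ IsPow q ∧ q < p := by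
  rcases (succ_le_iff.2 hp.1).eq_or_lt with h | h
  · rw [zero_add] at h
    exact .inl h.symm
  · rw [zero_add] at h
    obtain ⟨q, rfl, hq⟩ := hp.half h
    exact .inr ⟨q, rfl, hq, lt_mul_of_one_lt_left hq.1 one_lt_two⟩

theorem IsPow.mul (X : Set (Set N)) [Arith X] {p q : N} (hp : IsPow p) (hq : IsPow q) : IsPow (p * q) := by
  refine strong_ind (X := X) (P := fun p => IsPow p → IsPow (p * q))
    (.imp (.isPow (.var 0)) (.isPow ((F0.var 0).mul (.const q)))) (fun p ih hp => ?_) p hp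
  rcases hp.one_or_double with rfl | ⟨r, rfl, hr, hlt⟩
  · rwa [one_mul]
  · rw [mul_assoc]
    exact (ih r hlt hr).double X

/-- Both powers are halved until the smaller one is `1`. The larger one changes too, so the
induction is over a statement about all `r ≤ q`. -/
theorem IsPow.dvd_of_le (X : Set (Set N)) [Arith X] {p q : N} (hp : IsPow p) (hq : IsPow q) (h : p ≤ q) : p ∣ q := by
  refine strong_ind (X := X) (P := fun p => ∀ r, r ≤ q → IsPow p → IsPow r → p ≤ r → p ∣ r)
    (.all_le (R := fun v r => IsPow (v 0) → IsPow r → v 0 ≤ r → v 0 ∣ r) (.const q)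
      (.imp (.isPow (.var _)) (.imp (.isPow .last) (.imp (.le (.var _) .last)
        (.dvd (.var _) .last))))) (fun p ih r hr hp hr' hle => ?_) p q le_rfl hp hq h
  rcases hp.one_or_double with rfl | ⟨p, rfl, hp', hlt⟩
  · exact one_dvd r
  · rcases hr'.one_or_double with rfl | ⟨r, rfl, hr'', hlt'⟩
    · exact absurd (hle.trans (by simpa using succ_le_iff.2 hp'.1)) hlt.not_ge
    · exact mul_dvd_mul_left 2 (ih p hlt r (hlt'.le.trans hr) hp' hr''
        (le_of_mul_le_mul_left hle two_pos))

theorem IsPow.two_mul_le (X : Set (Set N)) [Arith X] {p q : N} (hp : IsPow p) (hq : IsPow q) (h : p < q) : 2 * p ≤ q := by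
  obtain ⟨k, rfl⟩ := hp.dvd_of_le X hq h.le
  rw [mul_comm p]
  refine mul_le_mul_left ?_ p
  rw [← one_add_one_eq_two, succ_le_iff]
  by_contra! hk
  exact absurd h (mul_le_of_le_one_right zero_le hk).not_gt

/-- The strings of a given length are those coded by the `t` with `p ≤ t < 2 * p` for one power of
two `p`. This `p` serves as the level of `t`, in place of the length. -/
theorem IsPow.eq_of_level (X : Set (Set N)) [Arith X] {p q t : N} (hp : IsPow p) (hq : IsPow q) (h₁ : p ≤ t) (h₂ : t < 2 * p)
    (h₃ : q ≤ t) (h₄ : t < 2 * q) : p = q := by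
  rcases lt_trichotomy p q with h | h | h
  · exact absurd (h₂.trans_le ((hp.two_mul_le X hq h).trans h₃)) (lt_irrefl _)
  · exact h
  · exact absurd (h₄.trans_le ((hq.two_mul_le X hp h).trans h₁)) (lt_irrefl _)

theorem exists_level (X : Set (Set N)) [Arith X] {t : N} (ht : 0 < t) : ∃ q, IsPow q ∧ q ≤ t ∧ t < 2 * q := by
  have key : ∀ t : N, ∃ q, q ≤ t + 1 ∧ IsPow q ∧ t + 1 < 2 * q := by
    refine ind (X := X) (.ex_le (R := fun v q => IsPow q ∧ v 0 + 1 < 2 * q) (F0.succ (.var 0))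
      (.and (.isPow .last) (.lt' (F0.succ (.var _)) ((F0.const 2).mul .last)))) ?_ ?_
    · exact ⟨1, by simp, isPow_one, by simp⟩
    · rintro t ⟨q, hq, hp, hlt⟩
      rcases (succ_le_iff.2 hlt).eq_or_lt with h | h
      · refine ⟨2 * q, h.ge, hp.double X, ?_⟩
        rw [h]
        exact lt_mul_of_one_lt_left (hp.double X).1 one_lt_two
      · exact ⟨q, hq.trans le_self_add, hp, h⟩
  rcases eq_zero_or_succ t with rfl | ⟨t, rfl⟩
  · exact (lt_irrefl _ ht).elim
  · obtain ⟨q, h₁, h₂, h₃⟩ := key t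
    exact ⟨q, h₂, h₁, h₃⟩

/-- If `t` has level `L * p`, its initial segment of level `L` is the quotient of `t` by `p`. The
quotient is obtained as the least `s` with `t < (s + 1) * p`. -/
theorem exists_isInit_of_le (X : Set (Set N)) [Arith X] {L t : N} (hL : IsPow L) (h : L ≤ t) :
    ∃ s, IsInit s t ∧ L ≤ s ∧ s < 2 * L := by
  obtain ⟨q, hq, h₁, h₂⟩ := exists_level X (hL.1.trans_le h)
  have hLq : L ≤ q := by
    by_contra! hlt
    exact absurd (h₂.trans_le ((hq.two_mul_le X hL hlt).trans h)) (lt_irrefl _)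
  obtain ⟨p, rfl⟩ := hL.dvd_of_le X hq hLq
  have hp := hq.of_dvd (dvd_mul_left p L)
  obtain ⟨s, r, hr, rfl⟩ : ∃ s r, r < p ∧ t = s * p + r := by
    obtain ⟨s, hs, hs'⟩ := exists_least (X := X) (P := fun s => t < (s + 1) * p)
      (.lt' (.const t) ((F0.succ (.var 0)).mul (.const p))) (a := t) (by
        refine (lt_succ_iff.2 le_rfl).trans_le (le_mul_of_one_le_right zero_le ?_)
        simpa using succ_le_iff.2 hp.1)
    have hle : s * p ≤ t := by
      rcases eq_zero_or_succ s with rfl | ⟨s, rfl⟩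
      · simp
      · exact not_lt.1 (hs' s (lt_succ_iff.2 le_rfl))
    obtain ⟨r, rfl⟩ := exists_add_of_le hle
    rw [add_mul, one_mul] at hs
    exact ⟨s, r, lt_of_add_lt_add_left hs, rfl⟩
  have hLs : L ≤ s := by
    by_contra! hlt
    have := mul_le_mul_left (succ_le_iff.2 hlt) p
    rw [add_mul, one_mul] at this
    exact absurd ((add_lt_add_right hr (s * p)).trans_le (this.trans h₁)) (lt_irrefl _)
  refine ⟨s, ⟨hL.1.trans_le hLs, p, r, hp, hr, rfl⟩, hLs, ?_⟩
  rw [← mul_assoc] at h₂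
  exact lt_of_mul_lt_mul_right (le_self_add.trans_lt h₂) zero_le

theorem IsInit.trans (X : Set (Set N)) [Arith X] {s t t' : N} (h : IsInit s t) (h' : IsInit t t') : IsInit s t' := by
  obtain ⟨hs, p, r, hp, hr, rfl⟩ := h
  obtain ⟨_, p', r', hp', hr', rfl⟩ := h'
  refine ⟨hs, p * p', r * p' + r', hp.mul X hp', ?_, by ring⟩
  have := mul_le_mul_left (succ_le_iff.2 hr) p'
  rw [add_mul, one_mul] at this
  exact (add_lt_add_right hr' _).trans_le this

theorem IsInit.eq_of_level {s t L : N} (h : IsInit s t) (hs : L ≤ s) (ht : t < 2 * L) : s = t := by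
  obtain ⟨_, p, r, hp, hr, rfl⟩ := h
  rcases hp.one_or_double with rfl | ⟨q, rfl, hq, _⟩
  · have : r = 0 := by
      rw [← zero_add 1, lt_succ_iff] at hr
      exact le_antisymm hr zero_le
    rw [this, mul_one, add_zero]
  · refine absurd ht (not_lt.2 ?_)
    calc 2 * L ≤ 2 * s := mul_le_mul_right hs 2
      _ ≤ 2 * s * q := le_mul_of_one_le_right zero_le (by simpa using succ_le_iff.2 hq.1)
      _ = s * (2 * q) := by ring
      _ ≤ _ := le_self_add

/-! ### The tree -/

/-- Below `K` there is a witness for `W` at `p` that precedes all witnesses for `W'`. -/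
def Wins (W W' : N → N → Prop) (p K : N) : Prop :=
  ∃ w, w < K ∧ W p w ∧ ∀ w', w' ≤ w → ¬ W' p w'

/-- At every level, the string coded by `t` avoids the value that has won below `K`. -/
def Avoids (W W' : N → N → Prop) (K t : N) : Prop :=
  ∀ s, s ≤ t → IsInit s t → ∀ p, p ≤ t → IsPow p → ∀ u, u ≤ t → p ≤ u ∧ u < 2 * p →
    (s = 2 * u → ¬ Wins W W' p K) ∧ (s = 2 * u + 1 → ¬ Wins W' W p K)

theorem Wins.mono {W W' : N → N → Prop} {p K K' : N} (hK : K ≤ K') (h : Wins W W' p K) :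
    Wins W W' p K' := by
  obtain ⟨w, hw, h⟩ := h
  exact ⟨w, hw.trans_le hK, h⟩

/-- The earlier witness decides, so at each level at most one bit is forbidden. Hence nothing has to
be known about uniqueness of the outputs of arbitrary programs. -/
theorem Wins.not_wins {W W' : N → N → Prop} {p K K' : N} (h : Wins W W' p K) :
    ¬ Wins W' W p K' := by
  rintro ⟨w', _, h₁', h₂'⟩
  obtain ⟨w, _, h₁, h₂⟩ := h
  rcases le_total w w' with hle | hle
  exacts [h₂' w hle h₁, h₂ w' hle h₁']

theorem Avoids.anti {W W' : N → N → Prop} {K K' t : N} (hK : K ≤ K') (h : Avoids W W' K' t) :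
    Avoids W W' K t := fun s hs hst p hp hp' u hu hpu =>
  have := h s hs hst p hp hp' u hu hpu
  ⟨fun e hw => this.1 e (hw.mono hK), fun e hw => this.2 e (hw.mono hK)⟩

/-- The bounds by `t` in `Avoids` only serve to make it `Δ⁰₀`: from `2 * u ≤ s ≤ t` it follows that
`p ≤ u ≤ t`. -/
theorem Avoids.apply {W W' : N → N → Prop} {K s t p u : N} (h : Avoids W W' K t)
    (hst : IsInit s t) (hp : IsPow p) (h₁ : p ≤ u) (h₂ : u < 2 * p) :
    (s = 2 * u → ¬ Wins W W' p K) ∧ (s = 2 * u + 1 → ¬ Wins W' W p K) := by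
  have key : 2 * u ≤ s → u ≤ t := fun hu =>
    (le_mul_of_one_le_left zero_le one_le_two).trans (hu.trans hst.le)
  refine ⟨fun e => ?_, fun e => ?_⟩
  · have := key e.ge
    exact (h s hst.le hst p (h₁.trans this) hp u this ⟨h₁, h₂⟩).1 e
  · have := key (e ▸ le_self_add)
    exact (h s hst.le hst p (h₁.trans this) hp u this ⟨h₁, h₂⟩).2 e

theorem Avoids.of_isInit (X : Set (Set N)) [Arith X] {W W' : N → N → Prop} {K s t : N}
    (h : Avoids W W' K t) (hst : IsInit s t) : Avoids W W' K s :=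
  fun _ _ hr _ _ hp _ _ hpu => h.apply (hr.trans X hst) hp hpu.1 hpu.2

section

variable {W W' : N → N → Prop} (hW : D0 X (fun v : Fin 2 → N => W (v 0) (v 1)))
  (hW' : D0 X (fun v : Fin 2 → N => W' (v 0) (v 1)))

include hW hW'

theorem D0.wins (hf : F0 X f) (hg : F0 X g) : D0 X (fun v => Wins W W' (f v) (g v)) :=
  .ex (R := fun v w => W (f v) w ∧ ∀ w', w' ≤ w → ¬ W' (f v) w') hg
    (.and (hW.comp₂ hf.wk .last) (.all_le (R := fun v w' => ¬ W' (f (Fin.init v)) w') .last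
      (hW'.comp₂ hf.wk.wk .last).not))

theorem D0.avoids (hf : F0 X f) (hg : F0 X g) : D0 X (fun v => Avoids W W' (f v) (g v)) := by
  -- The variables are, in this order, `K`, `t`, `s`, `p`, `u`.
  have key : D0 X (fun v : Fin 5 → N =>
      v 3 ≤ v 4 ∧ v 4 < 2 * v 3 → (v 2 = 2 * v 4 → ¬ Wins W W' (v 3) (v 0)) ∧
        (v 2 = 2 * v 4 + 1 → ¬ Wins W' W (v 3) (v 0))) :=
    .imp (.and (.le (.var _) (.var _)) (.lt' (.var _) ((F0.const 2).mul (.var _))))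
      (.and (.imp (.eq' (.var _) ((F0.const 2).mul (.var _)))
        (D0.wins hW hW' (.var _) (.var _)).not)
        (.imp (.eq' (.var _) ((F0.const 2).mul (.var _)).succ)
          (D0.wins hW' hW (.var _) (.var _)).not))
  have : D0 X (fun v : Fin 2 → N => Avoids W W' (v 0) (v 1)) :=
    .all_le (.var 1) (.imp (.isInit .last (.var 1)) (.all_le (.var 1) (.imp (.isPow .last)
      (.all_le (.var 1) key))))
  exact this.comp₂ hf hg

/-- A good string of the preceding level is extended by a bit that has not won. With `K` fixed the
claim is bounded, so `Δ⁰₀` induction along halving suffices. -/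
theorem exists_avoids (K q : N) (hq : IsPow q) : ∃ t, t < 2 * q ∧ q ≤ t ∧ Avoids W W' K t := by
  refine strong_ind (X := X) (P := fun q => IsPow q → ∃ t, t < 2 * q ∧ q ≤ t ∧ Avoids W W' K t)
    (.imp (.isPow (.var 0)) (.ex (R := fun v t => v 0 ≤ t ∧ Avoids W W' K t)
      ((F0.const 2).mul (.var 0)) (.and (.le (.var _) .last)
        (D0.avoids hW hW' (.const K) .last)))) (fun q ih hq => ?_) q hq
  -- The empty string has code `1` and no last bit, so there is nothing to avoid at the root.
  have hone : ∀ {u p s : N}, p ≤ u → IsPow p → (s = 2 * u ∨ s = 2 * u + 1) → ¬ s ≤ 1 := by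
    intro u p s hpu hp hs hle
    have h1 : 1 ≤ u := by simpa using succ_le_iff.2 (hp.1.trans_le hpu)
    have h2 : 2 * 1 ≤ s := by
      refine (mul_le_mul_right h1 2).trans ?_
      rcases hs with rfl | rfl
      exacts [le_rfl, le_self_add]
    rw [mul_one] at h2
    exact absurd (h2.trans hle) one_lt_two.not_ge
  rcases hq.one_or_double with rfl | ⟨q, rfl, hq', hlt⟩
  · refine ⟨1, by simp, le_rfl, fun s hs _ p _ hp u _ hpu => ⟨?_, ?_⟩⟩
    · exact fun e _ => hone hpu.1 hp (.inl e) hs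
    · exact fun e _ => hone hpu.1 hp (.inr e) hs
  obtain ⟨t, ht, hqt, hav⟩ := ih q hlt hq'
  obtain ⟨i, hi, h₀, h₁⟩ : ∃ i : N, i < 2 ∧ (i = 0 → ¬ Wins W W' q K) ∧
      (i = 1 → ¬ Wins W' W q K) := by
    by_cases h : Wins W W' q K
    · exact ⟨1, one_lt_two, fun h => (one_ne_zero h).elim, fun _ => h.not_wins⟩
    · exact ⟨0, two_pos, fun _ => h, fun h => (zero_ne_one h).elim⟩
  refine ⟨2 * t + i, ?_, (mul_le_mul_right hqt 2).trans le_self_add, ?_⟩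
  · calc 2 * t + i < 2 * t + 2 := add_lt_add_right hi _
      _ = 2 * (t + 1) := by ring
      _ ≤ 2 * (2 * q) := mul_le_mul_right (succ_le_iff.2 ht) 2
  rintro s - ⟨hs, p, r, hp, hr, e⟩ p' - hp' u - ⟨hu, hu'⟩
  -- An initial segment of `2 * t + i` is either the whole string, where the choice of `i` matters,
  -- or an initial segment of `t`.
  rcases hp.one_or_double with rfl | ⟨p, rfl, hp, -⟩
  · have : r = 0 := by
      rw [← zero_add 1, lt_succ_iff] at hr
      exact le_antisymm hr zero_le
    rw [this, mul_one, add_zero] at e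
    subst e
    have key : ∀ j, j < 2 → 2 * t + i = 2 * u + j → p' = q ∧ i = j := fun j hj e => by
      obtain ⟨rfl, rfl⟩ := two_mul_add_unique hi hj e
      exact ⟨hp'.eq_of_level X hq' hu hu' hqt ht, rfl⟩
    constructor
    · intro e
      obtain ⟨rfl, hi0⟩ := key 0 two_pos (by rw [e, add_zero])
      exact h₀ hi0
    · intro e
      obtain ⟨rfl, hi1⟩ := key 1 one_lt_two e
      exact h₁ hi1
  · obtain ⟨r, j, hj, rfl⟩ := exists_two_mul_add X r
    have e' : 2 * t + i = 2 * (s * p + r) + j := by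
      rw [e]
      ring
    obtain ⟨rfl, -⟩ := two_mul_add_unique hi hj e'
    refine hav.apply ⟨hs, p, r, hp, ?_, rfl⟩ hp' hu hu'
    exact lt_of_mul_lt_mul_left (le_self_add.trans_lt hr) zero_le

/-- A binary tree whose branches separate the levels where `W` wins from those where `W'` wins. -/
theorem exists_tree
    (hsep : ∀ D ∈ X, ∃ p, IsPow p ∧ (p ∈ D → (∃ w, W' p w) ∧ ∀ w, ¬ W p w) ∧
      (p ∉ D → (∃ w, W p w) ∧ ∀ w, ¬ W' p w)) :
    ∃ T ∈ X, IsBinTree T ∧ IsUnbounded T ∧ ∀ B ∈ X, ¬ IsBranch B T := by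
  -- A string is tested only against the wins below its own code. So membership is `Δ⁰₀`, and an
  -- initial segment, having a smaller code, faces a weaker test.
  refine ⟨{t | 0 < t ∧ Avoids W W' t t}, setOf_mem (.and (.lt' (.const 0) (.var 0))
    (D0.avoids hW hW' (.var 0) (.var 0))), ⟨fun t ht => ht.1, fun t s ht hst => ?_⟩,
    fun x => ?_, ?_⟩
  · exact ⟨hst.1, (ht.2.of_isInit X hst).anti hst.le⟩
  · obtain ⟨q, hq, _, hlt⟩ := exists_level X (t := x + 1) (lt_succ_iff.2 zero_le)
    -- All codes of level `2 * q` are below `2 * (2 * q)`, so avoiding the wins below this number is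
    -- more than membership demands.
    obtain ⟨t, ht, hqt, hav⟩ := exists_avoids hW hW' (2 * (2 * q)) (2 * q) (hq.double X)
    exact ⟨t, ⟨(hq.double X).1.trans_le hqt, hav.anti ht.le⟩,
      (lt_succ_iff.2 le_rfl).trans (hlt.trans_le hqt)⟩
  · rintro B hB ⟨⟨_, hcl⟩, hinf, hsub, hlin⟩
    -- The set of levels at which the branch continues with the bit `1`. It is bounded in `B`, hence
    -- a member of `X`.
    obtain ⟨p, hp, h₁, h₀⟩ := hsep {p | ∃ u, u < 2 * p ∧ p ≤ u ∧ 2 * u + 1 ∈ B}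
      (setOf_mem (.ex (R := fun v u => v 0 ≤ u ∧ 2 * u + 1 ∈ B) ((F0.const 2).mul (.var 0))
        (.and (.le (.var _) .last) (.mem' hB ((F0.const 2).mul .last).succ))))
    -- The branch contains a string `t` beyond `w` and beyond level `p`. Its initial segment of
    -- level `2 * p` ends in the bit `i` chosen at level `p`, and `t` is already tested against the
    -- witness `w`.
    have step : ∀ w, ∃ u i t, i < 2 ∧ w < t ∧ 2 * u + i ∈ B ∧ IsInit (2 * u + i) t ∧
        Avoids W W' t t ∧ p ≤ u ∧ u < 2 * p := by
      intro w
      obtain ⟨t, ht, hlt⟩ := hinf (w + 2 * p)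
      obtain ⟨s, hs, hs₁, hs₂⟩ := exists_isInit_of_le X (hp.double X) (le_add_self.trans hlt.le)
      obtain ⟨u, i, hi, rfl⟩ := exists_two_mul_add X s
      refine ⟨u, i, t, hi, le_self_add.trans_lt hlt, hcl t _ ht hs, hs, (hsub t ht).2, ?_, ?_⟩
      · by_contra! hu
        have h3 : 2 * (u + 1) ≤ 2 * p := mul_le_mul_right (succ_le_iff.2 hu) 2
        have h4 : 2 * u + i < 2 * (u + 1) := by
          rw [mul_add, mul_one]
          exact add_lt_add_right hi _
        exact absurd (h4.trans_le h3) hs₁.not_gt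
      · exact lt_of_mul_lt_mul_left (le_self_add.trans_lt hs₂) zero_le
    by_cases hD : p ∈ {p | ∃ u, u < 2 * p ∧ p ≤ u ∧ 2 * u + 1 ∈ B}
    · obtain ⟨⟨w, hw⟩, hno⟩ := h₁ hD
      obtain ⟨u, i, t, hi, hwt, huB, hut, hav, hu, hu'⟩ := step w
      obtain ⟨u', hu₁', hu₂', huB'⟩ := hD
      rcases lt_two_iff.1 hi with rfl | rfl
      -- The branch would have two different members of the same level, which cannot be comparable.
      · have hne : 2 * u + 0 ≠ 2 * u' + 1 := fun e =>
          zero_ne_one (two_mul_add_unique two_pos one_lt_two e).2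
        have hlt : ∀ v i : N, v < 2 * p → i < 2 → 2 * v + i < 2 * (2 * p) := fun v i hv hi =>
          calc 2 * v + i < 2 * v + 2 := add_lt_add_right hi _
            _ = 2 * (v + 1) := by ring
            _ ≤ 2 * (2 * p) := mul_le_mul_right (succ_le_iff.2 hv) 2
        have hle : ∀ v i : N, p ≤ v → 2 * p ≤ 2 * v + i := fun v i hv =>
          (mul_le_mul_right hv 2).trans le_self_add
        rcases hlin _ _ ⟨huB, huB'⟩ with h | h
        · exact hne (h.eq_of_level (hle _ _ hu) (hlt _ _ hu₁' one_lt_two))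
        · exact hne (h.eq_of_level (hle _ _ hu₂') (hlt _ _ hu' two_pos)).symm
      · exact (hav.apply hut hp hu hu').2 rfl ⟨w, hwt, hw, fun w' _ => hno w'⟩
    · obtain ⟨⟨w, hw⟩, hno⟩ := h₀ hD
      obtain ⟨u, i, t, hi, hwt, huB, hut, hav, hu, hu'⟩ := step w
      rcases lt_two_iff.1 hi with rfl | rfl
      · exact (hav.apply hut hp hu hu').1 (add_zero _) ⟨w, hwt, hw, fun w' _ => hno w'⟩
      · exact hD ⟨u, hu', hu, huB⟩

end

/-! ### Diagonalization against the computable sets -/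

/-- `w` witnesses that `p = 2 ^ e` for a program `e` that has output `i` on input `p`. -/
def Witness (J : Set N) (i p w : N) : Prop :=
  Justified J (left (right w)) ∧ El (fact (left w) p i) (left (right w)) ∧
    ExpSeq (left (right (right w))) (right (right (right w))) (left w) p

theorem D0.witness {J : Set N} (hJ : J ∈ X) (i : N) :
    D0 X (fun v : Fin 2 → N => Witness J i (v 0) (v 1)) :=
  have hw : F0 X (fun v : Fin 2 → N => v 1) := .var 1
  .and (.justified hJ hw.right.left) (.and (.el (.fact hw.left (.var 0) (.const i)) hw.right.left)
    (.expSeq hw.right.right.left hw.right.right.right hw.left (.var 0)))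

theorem ExpSeq.isPow (X : Set (Set N)) [Arith X] {a b x y : N} (h : ExpSeq a b x y) :
    IsPow y := by
  have : ∀ i, i ≤ x → IsPow (betaVal a b i) := by
    refine ind (X := X) (.imp (.le (.var 0) (.const x)) (.isPow (.betaVal a b (.var 0)))) ?_ ?_
    · intro _
      rw [h.betaVal_zero]
      exact isPow_one
    · intro i ih hi
      rw [succ_le_iff] at hi
      rw [h.betaVal_succ hi, ← two_mul]
      exact (ih hi.le).double X
  rw [← h.betaVal_last]
  exact this x le_rfl

/-- Given a program `e` for the characteristic function of `D`, the diagonal level is `p = 2 ^ e`.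
Injectivity of exponentiation makes `e` the only program that can have witnesses at `p`, and its
only output there is the value of `D`. -/
theorem exists_tree_compSets {J : Set N} (hJ : J ∈ X) :
    ∃ T ∈ compSets X J, IsBinTree T ∧ IsUnbounded T ∧ ∀ B ∈ compSets X J, ¬ IsBranch B T := by
  have : Arith (compSets X J) := arith_compSets hJ
  refine exists_tree (D0.witness (mem_compSets_self hJ) 0) (D0.witness (mem_compSets_self hJ) 1) ?_
  rintro D ⟨hD, e, he⟩
  obtain ⟨p, a, b, hp⟩ := Arith.exp X e
  have hex : ∀ i, i = chi (· ∈ D) p → ∃ w, Witness J i p w := fun i hi => by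
    obtain ⟨S, hS, h⟩ := (he p i).2 hi
    exact ⟨pair e (pair S (pair a b)), by simpa [Witness] using ⟨hS, h, hp⟩⟩
  have huniq : ∀ i w, Witness J i p w → i = chi (· ∈ D) p := by
    rintro i w ⟨h₁, h₂, h₃⟩
    rw [h₃.injective X hp] at h₂
    exact (he p i).1 ⟨_, h₁, h₂⟩
  refine ⟨p, hp.isPow X, fun h => ⟨hex 1 (by simp [chi, h]), fun w hw => ?_⟩,
    fun h => ⟨hex 0 (by simp [chi, h]), fun w hw => ?_⟩⟩
  · have := huniq _ _ hw
    simp [chi, h] at this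
  · have := huniq _ _ hw
    simp [chi, h] at this

end Tree

/-! ## Families of computable sets that contain given sets -/

section Subfamily

variable {N : Type u} [CommSemiring N] [LinearOrder N] [IsDiscretelyOrdered N] {X : Set (Set N)}
  [Arith X] {n : ℕ}

theorem exists_join (l : List (Set N)) (hl : ∀ A ∈ l, A ∈ X) :
    ∃ J ∈ X, ∀ A ∈ l, ∃ c : N, A = {x | pair c x ∈ J} := by
  induction l with
  | nil => exact ⟨{x | False}, setOf_mem .falsum, by simp⟩
  | cons A l ih =>
    obtain ⟨J, hJ, h⟩ := ih fun B hB => hl B (by simp [hB])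
    -- The new set receives the index `0`, and the indices of the others are shifted by one.
    refine ⟨{z | (left z = 0 ∧ right z ∈ A) ∨
        ∃ c, c < left z ∧ left z = c + 1 ∧ pair c (right z) ∈ J},
      setOf_mem (.or (.and (.eq' (.left (.var 0)) (.const 0))
        (.mem' (hl A (by simp)) (.right (.var 0))))
        (.ex (R := fun v c => left (v 0) = c + 1 ∧ pair c (right (v 0)) ∈ J) (.left (.var 0))
          (.and (.eq' (.left (.var _)) F0.last.succ)
            (.mem' hJ (.pair .last (.right (.var _))))))), fun B hB => ?_⟩
    rcases List.mem_cons.1 hB with rfl | hB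
    · exact ⟨0, by ext x; simp⟩
    · obtain ⟨c, hc⟩ := h B hB
      refine ⟨c + 1, ?_⟩
      rw [hc]
      ext x
      simp only [Set.mem_ofPred_eq, left_pair, right_pair]
      constructor
      · exact fun hx => .inr ⟨c, lt_succ_iff.2 le_rfl, rfl, hx⟩
      · rintro (⟨h0, _⟩ | ⟨d, _, hd, hx⟩)
        · exact ((lt_succ_iff.2 (zero_le (a := c))).ne' h0).elim
        · rwa [add_right_cancel hd]

theorem exists_subfamily (l : List (Set N)) (hl : ∀ A ∈ l, A ∈ X) :
    ∃ Y ⊆ X, (∀ A ∈ l, A ∈ Y) ∧ Arith Y ∧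
      ∃ T ∈ Y, IsBinTree T ∧ IsUnbounded T ∧ ∀ B ∈ Y, ¬ IsBranch B T := by
  obtain ⟨J, hJ, h⟩ := exists_join l hl
  have := arith_compSets hJ
  refine ⟨compSets X J, compSets_subset, fun A hA => ?_, this, exists_tree_compSets hJ⟩
  obtain ⟨c, rfl⟩ := h A hA
  exact setOf_mem (.mem' (mem_compSets_self hJ) (.pair (.const c) (.var 0)))

/-- Contraction of two like quantifiers. -/
theorem D0.contract {R : (Fin (n + 2) → N) → Prop} (hR : D0 X R) :
    D0 X (fun w : Fin (n + 1) → N => R (Fin.snoc (α := fun _ => N) (Fin.snoc (α := fun _ => N)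
      (Fin.init w) (left (w (Fin.last n)))) (right (w (Fin.last n))))) := by
  have := hR.comp (m := n + 1) (σ := Fin.snoc (α := fun _ => (Fin (n + 1) → N) → N)
    (Fin.snoc (α := fun _ => (Fin (n + 1) → N) → N) (fun i w => w i.castSucc)
      (fun w => left (w (Fin.last n)))) (fun w => right (w (Fin.last n)))) fun i => by
    refine Fin.lastCases ?_ (fun i => ?_) i
    · simpa using F0.last.right
    refine Fin.lastCases ?_ (fun i => ?_) i
    · simpa using F0.last.left
    · simpa using F0.var _
  refine this.congr fun v => ?_
  congr! 1
  funext i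
  refine Fin.lastCases ?_ (fun i => ?_) i
  · simp
  refine Fin.lastCases ?_ (fun i => ?_) i
  · simp
  · simp [Fin.init_def]

theorem D0.snoc_snoc_const {R : (Fin (n + 2) → N) → Prop} (hR : D0 X R) (c : Fin n → N) :
    D0 X (fun v : Fin 2 → N => R (Fin.snoc (α := fun _ => N)
      (Fin.snoc (α := fun _ => N) c (v 0)) (v 1))) := by
  have := hR.subst (m := 2) (σ := Fin.snoc (α := fun _ => (Fin 2 → N) → N)
    (Fin.snoc (α := fun _ => (Fin 2 → N) → N) (fun i _ => c i) (fun v => v 0)) (fun v => v 1))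
    fun i => by
      refine Fin.lastCases ?_ (fun i => ?_) i
      · simpa using .var _
      refine Fin.lastCases ?_ (fun i => ?_) i
      · simpa using .var _
      · simpa using .const _
  refine this.congr fun v => ?_
  congr! 1
  funext i
  refine Fin.lastCases ?_ (fun i => ?_) i
  · simp
  refine Fin.lastCases ?_ (fun i => ?_) i <;> simp

end Subfamily

/-! ## Models of `RCA*₀` -/

section Models

variable {M : Model.{u}} {k n : ℕ}

theorem Model.preArith (hM : ∀ ψ ∈ RCAStar0, M.Satisfies ψ) : PreArith M.sets := by
  have hb : ∀ {φ : Formula 0 2}, φ.close ∈ basicAxioms → ∀ x y, φ.Realize M Fin.elim0 ![x, y] :=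
    fun {φ} h x y =>
      (Model.satisfies_close φ).1 (hM _ (.inl (.inl (.inl h)))) _ (fun i => i.elim0) _
  exact
    { succ_ne_zero := fun x => hb (.inl rfl) x x
      succ_inj := fun x y => hb (.inr (.inl rfl)) x y
      add_zero := fun x => hb (.inr (.inr (.inl rfl))) x x
      add_succ := fun x y => hb (.inr (.inr (.inr (.inl rfl)))) x y
      mul_zero := fun x => hb (.inr (.inr (.inr (.inr (.inl rfl))))) x x
      mul_succ := fun x y => hb (.inr (.inr (.inr (.inr (.inr (.inl rfl)))))) x y
      not_lt_zero := fun x => hb (.inr (.inr (.inr (.inr (.inr (.inr (.inl rfl))))))) x x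
      lt_succ := fun x y => by
        simpa using hb (.inr (.inr (.inr (.inr (.inr (.inr (.inr rfl))))))) x y
      ind := fun P => Model.d0_induction fun θ h => hM θ (.inl (.inl (.inr h))) }

theorem PreArith.isDiscretelyOrdered {X : Set (Set M.carrier)} (h : PreArith X) :
    letI := h.commSemiring
    letI := h.linearOrder
    IsDiscretelyOrdered M.carrier := by
  let := h.commSemiring
  let := h.linearOrder
  exact { h.isStrictOrderedRing, h.canonicallyOrderedAdd with
    lt_add_one_iff' := fun {x y} => h.lt_succ x y }

theorem Formula.realize_betaEq (V : Fin k → Set M.carrier) (v : Fin n → M.carrier)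
    (a b i c : Term n) : (betaEq a b i c).Realize M V v ↔
      c.val M v < 1 + (i.val M v + 1) * b.val M v ∧
        ∃ q, a.val M v = q * (1 + (i.val M v + 1) * b.val M v) + c.val M v := by
  simp [betaEq]

theorem Model.arith (hM : ∀ ψ ∈ RCAStar0, M.Satisfies ψ) :
    letI := (Model.preArith hM).commSemiring
    letI := (Model.preArith hM).linearOrder
    Arith M.sets := by
  let := (Model.preArith hM).commSemiring
  let := (Model.preArith hM).linearOrder
  refine
    { ind := (Model.preArith hM).ind
      comprehension := fun P Q => Model.d1_comprehension fun θ h => hM θ (.inr h)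
      exp := fun x => ?_ }
  have h := hM expAxiom (.inl (.inr rfl)) x
  rw [Formula.realize_exNum] at h
  obtain ⟨y, h⟩ := h
  simp only [expEq, Formula.realize_exNum, Formula.realize_and, Formula.realize_betaEq,
    Formula.realize_ballNum, Term.val_lift] at h
  obtain ⟨a, b, h₁, h₂, h₃⟩ := h
  exact ⟨y, a, b, h₁, h₂, h₃⟩

/-! ### Passing to a smaller family of sets -/

/-- The model with the same numbers and the family `Y` of sets. -/
def Model.withSets (M : Model.{u}) (Y : Set (Set M.carrier)) (hY : Y.Nonempty) : Model.{u} where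
  carrier := M.carrier
  zero := M.zero
  one := M.one
  add := M.add
  mul := M.mul
  lt := M.lt
  sets := Y
  sets_nonempty := hY

theorem Term.val_withSets {Y : Set (Set M.carrier)} (hY : Y.Nonempty) (v : Fin n → M.carrier)
    (t : Term n) : t.val (M.withSets Y hY) v = t.val M v := by
  induction t with
  | var i => rfl
  | zero => rfl
  | one => rfl
  | add s t hs ht => simp only [Term.val, hs, ht]; rfl
  | mul s t hs ht => simp only [Term.val, hs, ht]; rfl

theorem IsArithmetical.realize_withSets {Y : Set (Set M.carrier)} (hY : Y.Nonempty)
    {φ : Formula k n} (hφ : IsArithmetical φ) (V : Fin k → Set M.carrier)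
    (v : Fin n → M.carrier) : φ.Realize (M.withSets Y hY) V v ↔ φ.Realize M V v := by
  induction hφ with
  | eq s t => simp only [Formula.Realize, Term.val_withSets]; rfl
  | lt s t => simp only [Formula.Realize, Term.val_withSets]; rfl
  | mem t i => simp only [Formula.Realize, Term.val_withSets]; rfl
  | falsum => rfl
  | imp _ _ h₁ h₂ => exact imp_congr (h₁ v) (h₂ v)
  | all _ ih => exact forall_congr' fun a => ih _

theorem IsSigma11.realize_of_withSets {Y : Set (Set M.carrier)} (hY : Y.Nonempty)
    (hsub : Y ⊆ M.sets) {φ : Formula k n} (hφ : IsSigma11 φ) (V : Fin k → Set M.carrier)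
    (v : Fin n → M.carrier) (h : φ.Realize (M.withSets Y hY) V v) : φ.Realize M V v := by
  induction hφ with
  | arith hφ => exact (hφ.realize_withSets hY V v).1 h
  | ex _ ih =>
    obtain ⟨S, hS, h⟩ := (Formula.realize_exSet (M.withSets Y hY) V v _).1 h
    exact (Formula.realize_exSet M V v _).2 ⟨S, hsub hS, ih _ v h⟩

/-- The list collects the values of the outer universal set quantifiers in a counterexample. While
these are kept, removing other sets only removes candidates for the existential quantifiers. -/
theorem IsPi12.exists_list {φ : Formula k n} (hφ : IsPi12 φ) (V : Fin k → Set M.carrier)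
    (v : Fin n → M.carrier) (h : ¬ φ.Realize M V v) :
    ∃ l : List (Set M.carrier), (∀ A ∈ l, A ∈ M.sets) ∧
      ∀ (Y : Set (Set M.carrier)) (hY : Y.Nonempty), Y ⊆ M.sets → (∀ A ∈ l, A ∈ Y) →
        ¬ φ.Realize (M.withSets Y hY) V v := by
  induction hφ with
  | sigma hφ =>
    exact ⟨[], by simp, fun Y hY hsub _ h' => h (hφ.realize_of_withSets hY hsub V v h')⟩
  | all _ ih =>
    rw [Formula.realize_allSet] at h
    push Not at h
    obtain ⟨S, hS, h⟩ := h
    obtain ⟨l, hl, h'⟩ := ih _ v h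
    refine ⟨S :: l, fun A hA => ?_, fun Y hY hsub hmem hr => ?_⟩
    · rcases List.mem_cons.1 hA with rfl | hA
      exacts [hS, hl A hA]
    · exact h' Y hY hsub (fun A hA => hmem A (by simp [hA])) (hr S (hmem S (by simp)))

section

variable {X : Set (Set M.carrier)} (h : PreArith X)
  (hX : letI := h.commSemiring; letI := h.linearOrder; Arith X)

include hX

theorem IsSigma01.d0 {φ : Formula k n} (hφ : IsSigma01 φ) {V : Fin k → Set M.carrier}
    (hV : ∀ i, V i ∈ X) : ∃ R : (Fin (n + 1) → M.carrier) → Prop, D0 X R ∧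
      ∀ v, φ.Realize M V v ↔ ∃ z, R (Fin.snoc (α := fun _ => M.carrier) v z) := by
  let := h.commSemiring
  let := h.linearOrder
  have := h.isDiscretelyOrdered
  induction hφ with
  | delta hφ =>
    -- A dummy quantifier is added; longer blocks are contracted to one quantifier by pairing.
    refine ⟨_, (hφ.d0 hV).wk, fun v => ?_⟩
    simp only [Fin.init_snoc, exists_const_iff]
    exact ⟨fun h => ⟨⟨M.zero⟩, h⟩, And.right⟩
  | ex _ ih =>
    obtain ⟨R, hR, e⟩ := ih
    refine ⟨_, D0.contract hR, fun v => ?_⟩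
    simp only [Formula.realize_exNum, e, Fin.init_snoc, Fin.snoc_last]
    exact ⟨fun ⟨a, b, h⟩ => ⟨pair a b, by simpa using h⟩, fun ⟨a, h⟩ => ⟨_, _, h⟩⟩

theorem IsPi01.d0 {φ : Formula k n} (hφ : IsPi01 φ) {V : Fin k → Set M.carrier}
    (hV : ∀ i, V i ∈ X) : ∃ R : (Fin (n + 1) → M.carrier) → Prop, D0 X R ∧
      ∀ v, φ.Realize M V v ↔ ∀ z, R (Fin.snoc (α := fun _ => M.carrier) v z) := by
  let := h.commSemiring
  let := h.linearOrder
  have := h.isDiscretelyOrdered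
  induction hφ with
  | delta hφ =>
    refine ⟨_, (hφ.d0 hV).wk, fun v => ?_⟩
    simp only [Fin.init_snoc]
    exact ⟨fun h _ => h, fun h => h M.zero⟩
  | all _ ih =>
    obtain ⟨R, hR, e⟩ := ih
    refine ⟨_, D0.contract hR, fun v => ?_⟩
    simp only [Formula.realize_allNum, e, Fin.init_snoc, Fin.snoc_last]
    exact ⟨fun h a => h _ _, fun h a b => by simpa using h (pair a b)⟩

end

theorem Model.satisfies_induction_comprehension (h : PreArith M.sets)
    (hX : letI := h.commSemiring; letI := h.linearOrder; Arith M.sets) :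
    ∀ ψ ∈ delta00Induction ∪ delta01Comprehension, M.Satisfies ψ := by
  let := h.commSemiring
  let := h.linearOrder
  have := h.isDiscretelyOrdered
  rintro ψ (⟨k, n, φ, hφ, rfl⟩ | ⟨k, n, φ, ψ, hφ, hψ, rfl⟩)
  · rw [Model.satisfies_inductionAxiom]
    intro V hV v
    exact h.ind (fun a => φ.Realize M V (Fin.snoc (α := fun _ => M.carrier) v a))
      (D0.snoc_const (hφ.d0 hV) v)
  · rw [Model.satisfies_comprehensionAxiom]
    intro V hV v e
    obtain ⟨R, hR, eR⟩ := hφ.d0 h hX hV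
    obtain ⟨S, hS, eS⟩ := hψ.d0 h hX hV
    simp only [eR, eS] at e ⊢
    exact hX.comprehension _ _ (D0.snoc_snoc_const hR v) (D0.snoc_snoc_const hS v) e

theorem Formula.realize_isPrefix (h : PreArith M.sets) (V : Fin k → Set M.carrier)
    (v : Fin n → M.carrier) (s t : Term n) :
    letI := h.commSemiring
    letI := h.linearOrder
    (isPrefix s t).Realize M V v ↔ IsInit (s.val M v) (t.val M v) := by
  let := h.commSemiring
  let := h.linearOrder
  have := h.isDiscretelyOrdered
  have hdvd : ∀ x y : M.carrier, (∃ q, x * q = y) ↔ x ∣ y := fun x y =>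
    ⟨fun ⟨q, e⟩ => ⟨q, e.symm⟩, fun ⟨q, e⟩ => ⟨q, e.symm⟩⟩
  have hpow : ∀ p : M.carrier, (0 < p ∧ ∀ d : M.carrier, (∃ q, d * q = p) ∧ 1 < d →
      ∃ q, (1 + 1) * q = d) ↔ IsPow p := fun p => by
    simp only [hdvd, IsPow, one_add_one_eq_two, and_imp]
  simp only [isPrefix, isPowTwo, dvd, Formula.realize_exNum, Formula.realize_and,
    Formula.realize_allNum, Formula.realize_imp, Formula.realize_lt, Formula.realize_eq,
    Term.val_lift, Term.val_new, Term.val_add, Term.val_mul, Term.val_one, Term.val_zero,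
    Term.val_var, Fin.snoc_last, Fin.snoc_castSucc]
  refine and_congr Iff.rfl (exists_congr fun p => exists_congr fun r => and_congr ?_ Iff.rfl)
  exact hpow p

theorem Model.satisfies_not_WKL (h : PreArith M.sets) {T : Set M.carrier} (hT : T ∈ M.sets)
    (hT' : letI := h.commSemiring; letI := h.linearOrder
      IsBinTree T ∧ IsUnbounded T ∧ ∀ B ∈ M.sets, ¬ IsBranch B T) : M.Satisfies WKL.not := by
  let := h.commSemiring
  let := h.linearOrder
  have := h.isDiscretelyOrdered
  have htree : ∀ {k : ℕ} (V : Fin k → Set M.carrier) (i : Fin k),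
      (isTree i).Realize M V Fin.elim0 ↔ IsBinTree (V i) := by
    intro k V i
    simp only [isTree, Formula.realize_and, Formula.realize_allNum, Formula.realize_imp,
      Formula.realize_isPrefix h, and_imp]
    exact Iff.rfl
  have hinf : ∀ {k : ℕ} (V : Fin k → Set M.carrier) (i : Fin k),
      (isInfinite i).Realize M V Fin.elim0 ↔ IsUnbounded (V i) := by
    intro k V i
    simp only [isInfinite, Formula.realize_and, Formula.realize_allNum, Formula.realize_exNum]
    exact Iff.rfl
  intro hW
  have hW := hW T hT
  rw [Formula.realize_imp, Formula.realize_and, htree, hinf, Formula.realize_exSet] at hW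
  obtain ⟨B, hB, hW⟩ := hW ⟨hT'.1, hT'.2.1⟩
  simp only [isInfiniteBranch, Formula.realize_and, htree, hinf, Formula.realize_allNum,
    Formula.realize_imp, Formula.realize_or, Formula.realize_isPrefix h] at hW
  exact hT'.2.2 B hB hW

theorem Model.exists_withSets (hM : ∀ ψ ∈ RCAStar0, M.Satisfies ψ) (l : List (Set M.carrier))
    (hl : ∀ A ∈ l, A ∈ M.sets) :
    ∃ (Y : Set (Set M.carrier)) (hY : Y.Nonempty), Y ⊆ M.sets ∧ (∀ A ∈ l, A ∈ Y) ∧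
      ∀ ψ ∈ RCAStar0 ∪ {WKL.not}, (M.withSets Y hY).Satisfies ψ := by
  have h := Model.preArith hM
  let := h.commSemiring
  let := h.linearOrder
  have := h.isDiscretelyOrdered
  have := Model.arith hM
  obtain ⟨Y, hsub, hlY, hA, T, hT, hT'⟩ := exists_subfamily (X := M.sets) l hl
  refine ⟨Y, ⟨T, hT⟩, hsub, hlY, ?_⟩
  -- Of the clauses of `PreArith`, only induction depends on the family of sets.
  have h' : PreArith (N := (M.withSets Y ⟨T, hT⟩).carrier) Y :=
    { h with ind := hA.ind }
  rintro ψ ((((hψ | hψ) | hψ) | hψ) | hψ)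
  -- The basic axioms, like `exp` below, contain no set quantifiers, so their truth in the two
  -- structures is the same by definition.
  · have hψ' := hM ψ (.inl (.inl (.inl hψ)))
    rcases hψ with rfl | rfl | rfl | rfl | rfl | rfl | rfl | rfl <;> exact hψ'
  · exact Model.satisfies_induction_comprehension h' hA ψ (.inl hψ)
  · obtain rfl := hψ
    have := hM expAxiom (.inl (.inr rfl))
    exact this
  · exact Model.satisfies_induction_comprehension h' hA ψ (.inr hψ)
  · obtain rfl := hψ
    exact Model.satisfies_not_WKL h' hT hT'

end Models

end SecondOrderArith

/-- `RCA*₀ + ¬WKL` is a `Π¹₂`-conservative extension of `RCA*₀`. -/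
theorem mainTheorem10 :
    SecondOrderArith.IsConservativeExtension.{u}
      (fun φ : SecondOrderArith.Sentence => SecondOrderArith.IsPi12 φ)
      (SecondOrderArith.RCAStar0 ∪ {SecondOrderArith.WKL.not})
      SecondOrderArith.RCAStar0 := by
  refine ⟨fun φ h M hM => h M fun ψ hψ => hM ψ (.inl hψ), fun φ hφ h M hM => ?_⟩
  by_contra hn
  -- The sets in `l` form the counterexample to `φ` in `M`, which survives in the smaller model of
  -- `¬WKL`.
  obtain ⟨l, hl, hl'⟩ := hφ.exists_list _ _ hn
  obtain ⟨Y, hY, hsub, hlY, hsat⟩ := SecondOrderArith.Model.exists_withSets hM l hl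
  exact hl' Y hY hsub hlY (h _ hsat)
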